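/- Let $K$ be an algebraically closed field of characteristic zero and let $H$ be a semisimple Hopf algebra over $K$ with coproduct $\Delta$ and counit $\varepsilon$ (such an $H$ is automatically finite-dimensional). For a left $H$-module $V$ and an integer $m\ge 1$, let $H$ act on $V^{\otimes m}=V\otimes_K\cdots\otimes_K V$ through the iterated coproduct, and let $$(V^{\otimes m})^H=\{x\in V^{\otimes m} : h\cdot x=\varepsilon(h)x \text{ for all } h\in H\}$$ be the space of invariants. The order $\operatorname{ord}(V)$ is the smallest integer $m\ge 1$ with $(V^{\otimes m})^H\neq 0$, and $\operatorname{ord}(V)=\infty$ if there is no such $m$. If $m=\operatorname{ord}(V)$ is finite, the multiplicity of $V$ is $\operatorname{mult}(V)=\dim_K\big((V^{\otimes m})^H\big)$. **Theorem.** Let $V$ be a nonzero $H$-module. Then $\operatorname{ord}(V)$ is finite and $\operatorname{ord}(V)\le\dim_K(H)$. Moreover, if $\operatorname{mult}(V)$ is finite (in particular, if $V$ is finite-dimensional), then $\operatorname{ord}(V)$ divides $\dim_K(H)\cdot\operatorname{mult}(V)$. -/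

import Mathlib

open scoped TensorProduct

noncomputable section

namespace HopfModule

/-- The tensor product of two representations `f : H → End M`, `g : H → End N` of a bialgebra:
`h` acts on `M ⊗ N` as `∑ f h₍₁₎ ⊗ g h₍₂₎`, where `Δ h = ∑ h₍₁₎ ⊗ h₍₂₎`. -/
def tensorRep {K H M N : Type*} [Field K] [Ring H] [Bialgebra K H]
    [AddCommGroup M] [Module K M] [AddCommGroup N] [Module K N]
    (f : H →ₐ[K] Module.End K M) (g : H →ₐ[K] Module.End K N) :
    H →ₐ[K] Module.End K (M ⊗[K] N) :=
  (Module.endTensorEndAlgHom.comp (Algebra.TensorProduct.map f g)).comp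
    (Bialgebra.comulAlgHom K H)

/-- The canonical identification `V^{⊗m} ⊗ V ≃ V^{⊗(m+1)}`. -/
def powSuccEquiv (K V : Type*) [Field K] [AddCommGroup V] [Module K V] (m : ℕ) :
    ((⨂[K]^m V) ⊗[K] V) ≃ₗ[K] (⨂[K]^(m + 1) V) :=
  (TensorProduct.congr (LinearEquiv.refl K (⨂[K]^m V))
    (PiTensorProduct.subsingletonEquiv (R := K) (s := fun _ : Fin 1 => V) 0).symm).trans
    TensorPower.mulEquiv

/-- The action of `H` on the tensor power `V^{⊗m}` of an `H`-module `V`: for `m = 0` this is the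
trivial action through the counit, and `V^{⊗(m+1)} = V^{⊗m} ⊗ V` as `H`-modules. -/
def powRep (K H V : Type*) [Field K] [Ring H] [Bialgebra K H]
    [AddCommGroup V] [Module K V] [Module H V] [IsScalarTower K H V] :
    (m : ℕ) → (H →ₐ[K] Module.End K (⨂[K]^m V))
  | 0 => (Algebra.ofId K (Module.End K (⨂[K]^0 V))).comp (Bialgebra.counitAlgHom K H)
  | m + 1 =>
      ((powSuccEquiv K V m).conjAlgEquiv K).toAlgHom.comp
        (tensorRep (powRep K H V m) (Algebra.lsmul K K V))

/-- The invariants of a representation of `H`: all `x` with `h x = ε(h) x` for every `h`. -/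
def invariants {K H M : Type*} [Field K] [Ring H] [Bialgebra K H]
    [AddCommGroup M] [Module K M] (f : H →ₐ[K] Module.End K M) : Submodule K M where
  carrier := {x | ∀ h : H, f h x = Coalgebra.counit (R := K) h • x}
  add_mem' := by
    intro a b ha hb h
    rw [map_add, ha h, hb h, smul_add]
  zero_mem' := by
    intro h
    rw [map_zero, smul_zero]
  smul_mem' := by
    intro c x hx h
    rw [map_smul, hx h, smul_comm]

/-- `(V^{⊗m})^H`. -/
def powInvariants (K H V : Type*) [Field K] [Ring H] [Bialgebra K H]
    [AddCommGroup V] [Module K V] [Module H V] [IsScalarTower K H V] (m : ℕ) :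
    Submodule K (⨂[K]^m V) :=
  invariants (powRep K H V m)

/-- The order of `V`: the smallest `m ≥ 1` such that `(V^{⊗m})^H ≠ 0`, and `⊤` (infinity)
if there is no such `m`. -/
def ord (K H V : Type*) [Field K] [Ring H] [Bialgebra K H]
    [AddCommGroup V] [Module K V] [Module H V] [IsScalarTower K H V] : ℕ∞ :=
  sInf {n : ℕ∞ | ∃ m : ℕ, 1 ≤ m ∧ powInvariants K H V m ≠ ⊥ ∧ n = m}

/-- The multiplicity of `V`: the dimension of `(V^{⊗m})^H`, where `m` is the order of `V`.
(It is only meaningful if the order is finite.) -/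
def mult (K H V : Type*) [Field K] [Ring H] [Bialgebra K H]
    [AddCommGroup V] [Module K V] [Module H V] [IsScalarTower K H V] : ℕ :=
  Module.finrank K (powInvariants K H V (ord K H V).toNat)

end HopfModule

end

/-!
Let `χ` be the character of a finite-dimensional `H`-module `V`, and let `R_χ` be the operator
`h ↦ ∑ h₍₁₎ χ(h₍₂₎)` on `H` (`rightConv χ`). Everything follows from the identity

  `Tr (R_χ ^ m) = dim H · dim (V^{⊗m})^H`   (`trace_rightConv_pow`),

which says that the numbers on the right are the power sums `p_m` of the `dim H` eigenvalues of
`R_χ`.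

* The unit of `H` is an eigenvector of `R_χ`, with eigenvalue `dim V ≠ 0`. In characteristic zero
  this prevents `p_1, …, p_{dim H}` from all vanishing (`exists_psum_ne_zero`), so the order is at
  most `dim H`.
* The characters of `H` generate a subring of `H*` that is finitely generated as an abelian group,
  so the eigenvalues of `R_χ` are algebraic integers (`isIntegral_of_hasEigenvalue`). If `m` is the
  order, then `p_1 = ⋯ = p_{m-1} = 0`, so Newton's identity reads `m e_m = ± p_m`. Here `e_m` is
  rational and an algebraic integer, thus an integer, and `m` divides `p_m` (`dvd_of_psum_eq`).

A module of infinite dimension is treated by passing to a finitely generated, hence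
finite-dimensional, submodule `W`. Invariants of `W^{⊗m}` are invariants of `V^{⊗m}`, and `W` may be
chosen so large that it carries all the invariants of `V^{⊗m}` if these form a space of finite
dimension (`exists_fg_le_range_powMap`).

The identity itself rests on the theorem of Larson and Radford that the antipode `S` satisfies
`S² = 1` (`IsHaarIntegral.antipode_antipode`). Let `Λ` be the two-sided integral with `ε(Λ) = 1`,
which exists by semisimplicity. The map `f ↦ ∑ f(Λ₍₁₎) Λ₍₂₎` from `H*` to `H` is bijective, which
makes `H` finite-dimensional and `S` bijective; the preimage `ℓ` of `1` is an integral of `H*`, and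
`Tr (R_χ S²) = ℓ(1) χ(Λ)` for every functional `χ` (`IsHaarIntegral.trace_rightConv`). If `S² = 1`,
this becomes `Tr R_χ = dim H · χ(Λ)`, and `χ(Λ)` is the dimension of the invariants when `χ` is
a character. As `R_χ ^ m` is the operator `R` of the character of `V^{⊗m}`, the identity follows.

The proof of `S² = 1` has three steps.

* Radford's formula says that `S⁴` is conjugation by a group-like element `a`
  (`IsHaarIntegral.antipode_pow_four`), so `S²` has finite order. It fixes the center of `H`, so it
  restricts to an inner automorphism of each matrix block, conjugation by some `g`, where its trace
  is `tr(g) tr(g⁻¹) = |tr(g)|² ≥ 0` under an embedding of the algebraic numbers into `ℂ`. The block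
  of `ε` contributes `1`, whence `ℓ(1) = Tr S² ≠ 0` (`trace_algEquiv_ne_zero`).
* Since `∑ h₍₁₎ ℓ(h₍₂₎) = ℓ(h) a`, taking `h = 1` shows that `a = 1` and `S⁴ = 1`.
* For the regular character `χ`, the functional `e = χ / dim H` is an idempotent of `H*`, and `R_e`
  commutes with `S²`. So `R_e S²` has an integral trace, which equals `Tr(S²) / dim H`. An
  involution of a space of dimension `n` whose trace is a nonzero integral multiple of `n` is `±1`,
  and `S²(1) = 1`.
-/

noncomputable section

namespace HopfModule

open Coalgebra HopfAlgebra LinearMap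

/-! ### Convolution with a functional, and integrals -/

section Bialgebra

variable {K H : Type*} [Field K] [Ring H] [Bialgebra K H]

/-- The operator `h ↦ ∑ f(h₍₁₎) h₍₂₎` attached to a linear functional `f`. -/
def leftConv (f : H →ₗ[K] K) : H →ₗ[K] H :=
  (TensorProduct.lid K H).toLinearMap ∘ₗ f.rTensor H ∘ₗ comul

/-- The operator `h ↦ ∑ h₍₁₎ g(h₍₂₎)` attached to a linear functional `g`. -/
def rightConv (g : H →ₗ[K] K) : H →ₗ[K] H :=
  (TensorProduct.rid K H).toLinearMap ∘ₗ g.lTensor H ∘ₗ comul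

lemma leftConv_apply (f : H →ₗ[K] K) (h : H) :
    leftConv f h = TensorProduct.lid K H (f.rTensor H (comul h)) := rfl

lemma rightConv_apply (g : H →ₗ[K] K) (h : H) :
    rightConv g h = TensorProduct.rid K H (g.lTensor H (comul h)) := rfl

lemma leftConv_repr (f : H →ₗ[K] K) {h : H} {ι : Type*} (r : Repr K h ι) :
    leftConv f h = ∑ i ∈ r.index, f (r.left i) • r.right i := by
  simp [leftConv_apply, ← r.eq]

lemma rightConv_repr (g : H →ₗ[K] K) {h : H} {ι : Type*} (r : Repr K h ι) :
    rightConv g h = ∑ i ∈ r.index, g (r.right i) • r.left i := by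
  simp [rightConv_apply, ← r.eq]

lemma apply_leftConv (f g : H →ₗ[K] K) (h : H) : g (leftConv f h) = f (rightConv g h) := by
  simp [leftConv_repr f (ℛ K h), rightConv_repr g (ℛ K h), mul_comm]

lemma comul_comp_rightConv (g : H →ₗ[K] K) :
    comul ∘ₗ rightConv g = (rightConv g).lTensor H ∘ₗ comul := by
  have h1 : comul (R := K) ∘ₗ (TensorProduct.rid K H).toLinearMap ∘ₗ g.lTensor H =
      (TensorProduct.rid K (H ⊗[K] H)).toLinearMap ∘ₗ g.lTensor (H ⊗[K] H) ∘ₗ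
        comul.rTensor H := by
    ext; simp
  have h2 : (TensorProduct.rid K (H ⊗[K] H)).toLinearMap ∘ₗ g.lTensor (H ⊗[K] H) =
      ((TensorProduct.rid K H).toLinearMap ∘ₗ g.lTensor H).lTensor H ∘ₗ
        (TensorProduct.assoc K H H H).toLinearMap := by
    ext; simp
  calc comul ∘ₗ rightConv g
      = (comul (R := K) ∘ₗ (TensorProduct.rid K H).toLinearMap ∘ₗ g.lTensor H) ∘ₗ comul := rfl
    _ = ((TensorProduct.rid K (H ⊗[K] H)).toLinearMap ∘ₗ g.lTensor (H ⊗[K] H)) ∘ₗ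
        (comul.rTensor H ∘ₗ comul) := by rw [h1]; rfl
    _ = ((TensorProduct.rid K H).toLinearMap ∘ₗ g.lTensor H).lTensor H ∘ₗ
        ((TensorProduct.assoc K H H H).toLinearMap ∘ₗ comul.rTensor H ∘ₗ comul) := by
          rw [h2]; rfl
    _ = _ := by
      rw [Coalgebra.coassoc]
      simp only [rightConv, LinearMap.lTensor_comp, LinearMap.comp_assoc]

lemma comul_comp_leftConv (f : H →ₗ[K] K) :
    comul ∘ₗ leftConv f = (leftConv f).rTensor H ∘ₗ comul := by
  have h1 : comul (R := K) ∘ₗ (TensorProduct.lid K H).toLinearMap ∘ₗ f.rTensor H =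
      (TensorProduct.lid K (H ⊗[K] H)).toLinearMap ∘ₗ f.rTensor (H ⊗[K] H) ∘ₗ
        comul.lTensor H := by
    ext; simp
  have h2 : (TensorProduct.lid K (H ⊗[K] H)).toLinearMap ∘ₗ f.rTensor (H ⊗[K] H) ∘ₗ
        (TensorProduct.assoc K H H H).toLinearMap =
      ((TensorProduct.lid K H).toLinearMap ∘ₗ f.rTensor H).rTensor H := by
    ext; simp [TensorProduct.smul_tmul']
  calc comul ∘ₗ leftConv f
      = (comul (R := K) ∘ₗ (TensorProduct.lid K H).toLinearMap ∘ₗ f.rTensor H) ∘ₗ comul := rfl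
    _ = (TensorProduct.lid K (H ⊗[K] H)).toLinearMap ∘ₗ f.rTensor (H ⊗[K] H) ∘ₗ
        (comul.lTensor H ∘ₗ comul) := by rw [h1]; rfl
    _ = ((TensorProduct.lid K (H ⊗[K] H)).toLinearMap ∘ₗ f.rTensor (H ⊗[K] H) ∘ₗ
        (TensorProduct.assoc K H H H).toLinearMap) ∘ₗ comul.rTensor H ∘ₗ comul := by
          rw [← Coalgebra.coassoc]; rfl
    _ = _ := by
      rw [h2]
      simp only [leftConv, LinearMap.rTensor_comp, LinearMap.comp_assoc]

lemma rightConv_comp (f g : H →ₗ[K] K) :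
    rightConv (f ∘ₗ rightConv g) = rightConv f ∘ₗ rightConv g := by
  ext h
  have := congr($(comul_comp_rightConv g) h)
  simp only [LinearMap.comp_apply] at this
  simp [rightConv_apply f, this, rightConv_apply (f ∘ₗ rightConv g), LinearMap.lTensor_comp]

lemma leftConv_comp (f g : H →ₗ[K] K) :
    leftConv (f ∘ₗ leftConv g) = leftConv f ∘ₗ leftConv g := by
  ext h
  have := congr($(comul_comp_leftConv g) h)
  simp only [LinearMap.comp_apply] at this
  simp [leftConv_apply f, this, leftConv_apply (f ∘ₗ leftConv g), LinearMap.rTensor_comp]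

@[simp] lemma leftConv_one (f : H →ₗ[K] K) : leftConv f 1 = f 1 • 1 := by
  simp [leftConv_apply, Algebra.TensorProduct.one_def]

@[simp] lemma rightConv_one (f : H →ₗ[K] K) : rightConv f 1 = f 1 • 1 := by
  simp [rightConv_apply, Algebra.TensorProduct.one_def]

@[simp] lemma counit_rightConv (g : H →ₗ[K] K) (h : H) : counit (R := K) (rightConv g h) = g h := by
  rw [rightConv_repr g (ℛ K h)]
  have := congr(g $(sum_counit_smul (R := K) (ℛ K h)))
  simpa [mul_comm] using this

@[simp] lemma rightConv_counit : rightConv (counit (R := K) (A := H)) = LinearMap.id := by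
  ext h
  simp [rightConv_apply]

/-- A two-sided integral of a bialgebra, normalized by `ε(Λ) = 1`. -/
structure IsHaarIntegral (K : Type*) {H : Type*} [Field K] [Ring H] [Bialgebra K H]
    (Λ : H) : Prop where
  mul_left : ∀ h : H, h * Λ = counit (R := K) h • Λ
  mul_right : ∀ h : H, Λ * h = counit (R := K) h • Λ
  counit_eq : counit (R := K) Λ = 1

/-- The kernel of an augmentation `ε` of a semisimple algebra has a complementary left ideal, and
this complement is spanned by a left integral. -/
lemma exists_left_integral {K A : Type*} [Field K] [Ring A] [Algebra K A] [IsSemisimpleRing A]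
    (ε : A →ₐ[K] K) : ∃ x : A, (∀ h : A, h * x = ε h • x) ∧ ε x = 1 := by
  let I : Submodule A A := RingHom.ker ε
  obtain ⟨J, hJ⟩ := exists_isCompl I
  obtain ⟨x, hx, y, hy, hxy⟩ :=
    Submodule.mem_sup.1 (hJ.sup_eq_top ▸ Submodule.mem_top : (1 : A) ∈ I ⊔ J)
  have hx' : ε x = 0 := hx
  have hy1 : ε y = 1 := by
    have := congr(ε $hxy)
    simpa [hx'] using this
  refine ⟨y, fun h ↦ ?_, hy1⟩
  rw [← sub_eq_zero]
  refine (Submodule.disjoint_def.1 hJ.disjoint) _ ?_ ?_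
  · change ε (h * y - ε h • y) = 0
    simp [hy1]
  · rw [Algebra.smul_def]
    exact J.sub_mem (J.smul_mem h hy) (J.smul_mem (algebraMap K A (ε h)) hy)

lemma exists_isHaarIntegral (K H : Type*) [Field K] [Ring H] [Bialgebra K H]
    [IsSemisimpleRing H] : ∃ Λ : H, IsHaarIntegral K Λ := by
  obtain ⟨x, hx, hx1⟩ := exists_left_integral (Bialgebra.counitAlgHom K H)
  obtain ⟨y, hy, hy1⟩ := exists_left_integral
    ((AlgEquiv.toOpposite K K).symm.toAlgHom.comp (AlgHom.op (Bialgebra.counitAlgHom K H)))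
  have hy' (h : H) : y.unop * h = counit (R := K) h • y.unop :=
    congr(MulOpposite.unop $(hy (MulOpposite.op h)))
  have hy1' : counit (R := K) y.unop = 1 := hy1
  have hx1' : counit (R := K) x = 1 := hx1
  have hxy : x = y.unop := by
    have h1 : y.unop * x = counit (R := K) y.unop • x := hx _
    rw [hy', hx1', hy1', one_smul, one_smul] at h1
    exact h1.symm
  exact ⟨x, hx, hxy ▸ hy', hx1⟩

end Bialgebra

/-! ### The integral of a semisimple Hopf algebra -/

section Integral

variable {K H : Type*} [Field K] [Ring H] [HopfAlgebra K H]

/-- `∑ S(h₍₁₎) h₍₂₎ ⊗ h₍₃₎ = 1 ⊗ h`. -/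
lemma sum_antipode_tmul_one_mul_comul {h : H} {ι : Type*} (r : Repr K h ι) :
    ∑ i ∈ r.index, (antipode K (r.left i) ⊗ₜ[K] (1 : H)) * comul (R := K) (r.right i) = 1 ⊗ₜ h := by
  let F : H ⊗[K] (H ⊗[K] H) →ₗ[K] H ⊗[K] H :=
    TensorProduct.lift (LinearMap.mul K (H ⊗[K] H) ∘ₗ
      (TensorProduct.mk K H H).flip 1 ∘ₗ antipode K)
  have hF : F ∘ₗ (TensorProduct.assoc K H H H).toLinearMap =
      (LinearMap.mul' K H ∘ₗ (antipode K (A := H)).rTensor H).rTensor H := by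
    ext; simp [F]
  have := congr(F $(Coalgebra.coassoc_apply (R := K) h))
  rw [← LinearEquiv.coe_coe, ← LinearMap.comp_apply, hF, ← LinearMap.comp_apply,
    ← LinearMap.rTensor_comp, LinearMap.comp_assoc, mul_antipode_rTensor_comul,
    LinearMap.rTensor_comp, LinearMap.comp_apply, rTensor_counit_comul] at this
  simp only [LinearMap.rTensor_tmul, Algebra.linearMap_apply, map_one] at this
  rw [this, ← r.eq]
  simp [F]

/-- `∑ h₍₁₎ ⊗ h₍₂₎ S(h₍₃₎) = h ⊗ 1`. -/
lemma sum_comul_mul_one_tmul_antipode {h : H} {ι : Type*} (r : Repr K h ι) :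
    ∑ i ∈ r.index, comul (R := K) (r.left i) * ((1 : H) ⊗ₜ[K] antipode K (r.right i)) = h ⊗ₜ 1 := by
  let F : (H ⊗[K] H) ⊗[K] H →ₗ[K] H ⊗[K] H :=
    TensorProduct.lift
      ((LinearMap.mul K (H ⊗[K] H)).compl₂ (TensorProduct.mk K H H 1 ∘ₗ antipode K))
  have hF : F ∘ₗ (TensorProduct.assoc K H H H).symm.toLinearMap =
      (LinearMap.mul' K H ∘ₗ (antipode K (A := H)).lTensor H).lTensor H := by
    ext; simp [F]
  have := congr(F $(Coalgebra.coassoc_symm_apply (R := K) h))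
  rw [← LinearEquiv.coe_coe, ← LinearMap.comp_apply, hF, ← LinearMap.comp_apply,
    ← LinearMap.lTensor_comp, LinearMap.comp_assoc, mul_antipode_lTensor_comul,
    LinearMap.lTensor_comp, LinearMap.comp_apply, lTensor_counit_comul] at this
  simp only [LinearMap.lTensor_tmul, Algebra.linearMap_apply, map_one] at this
  rw [this, ← r.eq]
  simp [F]

variable {Λ : H}

/-- `∑ Λ₍₁₎ ⊗ h Λ₍₂₎ = ∑ S(h) Λ₍₁₎ ⊗ Λ₍₂₎`. -/
lemma IsHaarIntegral.one_tmul_mul_comul (hΛ : IsHaarIntegral K Λ) (h : H) :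
    (1 ⊗ₜ[K] h) * comul (R := K) Λ = (antipode K h ⊗ₜ 1) * comul Λ := by
  rw [← sum_antipode_tmul_one_mul_comul (ℛ K h), Finset.sum_mul]
  simp_rw [mul_assoc, ← Bialgebra.comul_mul, hΛ.mul_left, map_smul, mul_smul_comm,
    ← smul_mul_assoc, ← Finset.sum_mul, TensorProduct.smul_tmul', ← TensorProduct.sum_tmul,
    ← map_smul, ← map_sum]
  congr
  exact (rightConv_repr (counit (R := K)) (ℛ K h)).symm.trans congr($(rightConv_counit) h)

/-- `∑ Λ₍₁₎ h ⊗ Λ₍₂₎ = ∑ Λ₍₁₎ ⊗ Λ₍₂₎ S(h)`. -/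
lemma IsHaarIntegral.comul_mul_tmul_one (hΛ : IsHaarIntegral K Λ) (h : H) :
    comul (R := K) Λ * (h ⊗ₜ[K] 1) = comul Λ * (1 ⊗ₜ antipode K h) := by
  rw [← sum_comul_mul_one_tmul_antipode (ℛ K h), Finset.mul_sum]
  simp_rw [← mul_assoc, ← Bialgebra.comul_mul, hΛ.mul_right, map_smul, smul_mul_assoc,
    ← mul_smul_comm, ← Finset.mul_sum, TensorProduct.smul_tmul', TensorProduct.smul_tmul,
    ← TensorProduct.tmul_sum, ← map_smul, ← map_sum, sum_counit_smul]

lemma IsHaarIntegral.leftConv_mulLeft (hΛ : IsHaarIntegral K Λ) (f : H →ₗ[K] K) (h : H) :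
    leftConv (f ∘ₗ mulLeft K (antipode K h)) Λ = h * leftConv f Λ := by
  have := congr(TensorProduct.lid K H (f.rTensor H $(hΛ.one_tmul_mul_comul h)))
  rw [← (ℛ K Λ).eq] at this
  simp only [Finset.mul_sum, map_sum, Algebra.TensorProduct.tmul_mul_tmul, one_mul,
    LinearMap.rTensor_tmul, TensorProduct.lid_tmul] at this
  simp [leftConv_repr _ (ℛ K Λ), Finset.mul_sum, this]

lemma IsHaarIntegral.rightConv_mulLeft (hΛ : IsHaarIntegral K Λ) (f : H →ₗ[K] K) (h : H) :
    rightConv (f ∘ₗ mulLeft K h) Λ = antipode K h * rightConv f Λ := by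
  have := congr(TensorProduct.rid K H (f.lTensor H $(hΛ.one_tmul_mul_comul h)))
  rw [← (ℛ K Λ).eq] at this
  simp only [Finset.mul_sum, map_sum, Algebra.TensorProduct.tmul_mul_tmul, one_mul,
    LinearMap.lTensor_tmul, TensorProduct.rid_tmul] at this
  simp [rightConv_repr _ (ℛ K Λ), Finset.mul_sum, this]

lemma IsHaarIntegral.leftConv_mulRight (hΛ : IsHaarIntegral K Λ) (f : H →ₗ[K] K) (h : H) :
    leftConv (f ∘ₗ mulRight K h) Λ = leftConv f Λ * antipode K h := by
  have := congr(TensorProduct.lid K H (f.rTensor H $(hΛ.comul_mul_tmul_one h)))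
  rw [← (ℛ K Λ).eq] at this
  simp only [Finset.sum_mul, map_sum, Algebra.TensorProduct.tmul_mul_tmul, mul_one,
    LinearMap.rTensor_tmul, TensorProduct.lid_tmul] at this
  simp [leftConv_repr _ (ℛ K Λ), Finset.sum_mul, this]

lemma IsHaarIntegral.rightConv_mulRight (hΛ : IsHaarIntegral K Λ) (f : H →ₗ[K] K) (h : H) :
    rightConv (f ∘ₗ mulRight K (antipode K h)) Λ = rightConv f Λ * h := by
  have := congr(TensorProduct.rid K H (f.lTensor H $(hΛ.comul_mul_tmul_one h)))
  rw [← (ℛ K Λ).eq] at this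
  simp only [Finset.sum_mul, map_sum, Algebra.TensorProduct.tmul_mul_tmul, mul_one,
    LinearMap.lTensor_tmul, TensorProduct.rid_tmul] at this
  simp [rightConv_repr _ (ℛ K Λ), Finset.sum_mul, this]

/-- The left ideal spanned by the legs `c i` in `Δ(Λ) = ∑ b i ⊗ c i`, for a basis `b`, contains
`∑ S(b i) (c i) = ε(Λ) = 1`. So `H` is spanned by finitely many elements, each of them of the form
`∑ f(Λ₍₁₎) Λ₍₂₎`. -/
lemma IsHaarIntegral.exists_finite_span (hΛ : IsHaarIntegral K Λ) :
    ∃ s : Set H, s.Finite ∧ Submodule.span K s = ⊤ ∧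
      ∀ x ∈ s, ∃ f : H →ₗ[K] K, leftConv f Λ = x := by
  classical
  let b := Module.Basis.ofVectorSpace K H
  obtain ⟨c, hc⟩ := TensorProduct.eq_repr_basis_left b (comul (R := K) Λ)
  have hconv (f : H →ₗ[K] K) : leftConv f Λ = ∑ i ∈ c.support, f (b i) • c i := by
    simp [leftConv_apply, ← hc, Finsupp.sum]
  have hcoord (j) : leftConv (b.coord j) Λ = c j := by
    rw [hconv]
    simpa [Finsupp.single_apply] using Eq.symm
  have hmem (f : H →ₗ[K] K) : leftConv f Λ ∈ Submodule.span K (c '' c.support) := by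
    rw [hconv]
    exact Submodule.sum_mem _ fun i hi ↦
      Submodule.smul_mem _ _ (Submodule.subset_span ⟨i, hi, rfl⟩)
  refine ⟨c '' c.support, c.support.finite_toSet.image c, ?_, ?_⟩
  · have hone : (1 : H) = ∑ i ∈ c.support, antipode K (b i) * c i := by
      have := mul_antipode_rTensor_comul_apply (R := K) Λ
      rw [hΛ.counit_eq, map_one, ← hc] at this
      simpa [Finsupp.sum] using this.symm
    rw [eq_top_iff]
    intro h _
    rw [← mul_one h, hone, Finset.mul_sum]
    refine Submodule.sum_mem _ fun i _ ↦ ?_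
    rw [← mul_assoc, ← hcoord, ← hΛ.leftConv_mulLeft]
    exact hmem _
  · rintro _ ⟨i, -, rfl⟩
    exact ⟨_, hcoord i⟩

lemma IsHaarIntegral.moduleFinite (hΛ : IsHaarIntegral K Λ) : Module.Finite K H := by
  obtain ⟨s, hs, hspan, -⟩ := hΛ.exists_finite_span
  exact ⟨⟨hs.toFinset, by simpa using hspan⟩⟩

/-- `f ↦ ∑ f(Λ₍₁₎) Λ₍₂₎`. -/
def slice (Λ : H) : (H →ₗ[K] K) →ₗ[K] H where
  toFun f := leftConv f Λ
  map_add' f g := by simp [leftConv_apply, LinearMap.rTensor_add]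
  map_smul' c f := by simp [leftConv_apply, LinearMap.rTensor_smul]

lemma slice_apply (f : H →ₗ[K] K) : slice Λ f = leftConv f Λ := rfl

lemma IsHaarIntegral.slice_surjective (hΛ : IsHaarIntegral K Λ) :
    Function.Surjective (slice (K := K) Λ) := by
  obtain ⟨s, -, hspan, hs⟩ := hΛ.exists_finite_span
  rw [← LinearMap.range_eq_top, eq_top_iff, ← hspan, Submodule.span_le]
  exact fun x hx ↦ hs x hx

lemma IsHaarIntegral.slice_injective (hΛ : IsHaarIntegral K Λ) :
    Function.Injective (slice (K := K) Λ) := by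
  have := hΛ.moduleFinite
  exact (LinearMap.injective_iff_surjective_of_finrank_eq_finrank
    (Subspace.dual_finrank_eq (K := K) (V := H))).2 hΛ.slice_surjective

lemma IsHaarIntegral.antipode_bijective (hΛ : IsHaarIntegral K Λ) :
    Function.Bijective (antipode K (A := H)) := by
  have := hΛ.moduleFinite
  have hinj : Function.Injective (antipode K (A := H)) := by
    rw [injective_iff_map_eq_zero]
    intro h hh
    obtain ⟨f, hf⟩ := hΛ.slice_surjective 1
    have := hΛ.leftConv_mulLeft f h
    rw [hh, ← slice_apply f, hf, mul_one] at this
    rw [← this]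
    simp [leftConv_apply]
  exact ⟨hinj, LinearMap.injective_iff_surjective.1 hinj⟩

end Integral

/-! ### The dual integral and the formula for the fourth power of the antipode -/

section DualIntegral
variable {K H : Type*} [Field K] [Ring H] [HopfAlgebra K H]

variable {Λ : H} {ℓ : H →ₗ[K] K}

/-- The functional `ℓ` with `∑ ℓ(Λ₍₁₎) Λ₍₂₎ = 1` is an integral of the dual: it satisfies
`∑ ℓ(h₍₁₎) h₍₂₎ = ℓ(h) 1` for all `h`. This and the next identity become
equalities of functionals when paired with an arbitrary functional, and `slice Λ` is injective on
functionals. -/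
lemma IsHaarIntegral.leftConv_eq (hΛ : IsHaarIntegral K Λ) (hℓ : leftConv ℓ Λ = 1) (h : H) :
    leftConv ℓ h = ℓ h • 1 := by
  rw [← Module.forall_dual_apply_eq_zero_iff K (leftConv ℓ h - ℓ h • 1) |>.1 ?_ |> sub_eq_zero.1]
  intro φ
  have : φ ∘ₗ leftConv ℓ = φ 1 • ℓ := by
    apply hΛ.slice_injective
    rw [slice_apply, leftConv_comp, map_smul, slice_apply, hℓ, LinearMap.comp_apply, hℓ,
      leftConv_one]
  have := congr($this h)
  simp only [LinearMap.comp_apply] at this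
  simp [this, mul_comm]

/-- The distinguished element `a = ∑ Λ₍₁₎ ℓ(Λ₍₂₎)` satisfies `∑ h₍₁₎ ℓ(h₍₂₎) = ℓ(h) a`. -/
lemma IsHaarIntegral.rightConv_eq (hΛ : IsHaarIntegral K Λ) (hℓ : leftConv ℓ Λ = 1) (h : H) :
    rightConv ℓ h = ℓ h • rightConv ℓ Λ := by
  rw [← Module.forall_dual_apply_eq_zero_iff K (rightConv ℓ h - ℓ h • rightConv ℓ Λ) |>.1 ?_
    |> sub_eq_zero.1]
  intro φ
  have : ℓ ∘ₗ leftConv φ = φ (rightConv ℓ Λ) • ℓ := by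
    apply hΛ.slice_injective
    rw [slice_apply, leftConv_comp, map_smul, slice_apply, hℓ, LinearMap.comp_apply,
      hΛ.leftConv_eq hℓ, apply_leftConv]
  have := congr($this h)
  simp only [LinearMap.comp_apply, apply_leftConv] at this
  simp [this, mul_comm]

lemma IsHaarIntegral.apply_eq_one (hΛ : IsHaarIntegral K Λ) (hℓ : leftConv ℓ Λ = 1) :
    ℓ Λ = 1 := by
  have h1 := congr(counit (R := K) $(hΛ.leftConv_eq hℓ Λ))
  rw [hℓ] at h1
  simpa using h1.symm

/-- An element of `H ⊗ H` is determined by the slices of its right factor. -/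
lemma comul_eq_tmul_self_of_rightConv {x y : H} (h : ∀ g : H →ₗ[K] K, rightConv g x = g y • y) :
    comul (R := K) x = y ⊗ₜ y := by
  classical
  let b := Module.Basis.ofVectorSpace K H
  apply (TensorProduct.equivFinsuppOfBasisRight (M := H) b).injective
  ext i
  have := h (b.coord i)
  rw [rightConv_apply] at this
  simp [TensorProduct.equivFinsuppOfBasisRight_apply, this]

lemma IsHaarIntegral.isGroupLikeElem (hΛ : IsHaarIntegral K Λ) (hℓ : leftConv ℓ Λ = 1) :
    IsGroupLikeElem K (rightConv ℓ Λ) where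
  counit_eq_one := by rw [counit_rightConv, hΛ.apply_eq_one hℓ]
  comul_eq_tmul_self := by
    refine comul_eq_tmul_self_of_rightConv fun g ↦ ?_
    have h2 : g ∘ₗ rightConv ℓ = g (rightConv ℓ Λ) • ℓ := by
      ext h
      simp [hΛ.rightConv_eq hℓ h, mul_comm]
    rw [← LinearMap.comp_apply, ← rightConv_comp, h2]
    simp [rightConv_apply, LinearMap.lTensor_smul]

/-- `ℓ(S³(h) x) = ℓ(x S(h))`. -/
lemma IsHaarIntegral.apply_antipode_mul (hΛ : IsHaarIntegral K Λ) (hℓ : leftConv ℓ Λ = 1) (h : H) :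
    ℓ ∘ₗ mulLeft K (antipode K (antipode K (antipode K h))) = ℓ ∘ₗ mulRight K (antipode K h) := by
  apply hΛ.slice_injective
  rw [slice_apply, slice_apply, hΛ.leftConv_mulLeft, hΛ.leftConv_mulRight, hℓ, mul_one, one_mul]

/-- Radford's formula for `S⁴` in the unimodular case. -/
lemma IsHaarIntegral.antipode_pow_four (hΛ : IsHaarIntegral K Λ) (hℓ : leftConv ℓ Λ = 1) (h : H) :
    rightConv ℓ Λ * h = antipode K (antipode K (antipode K (antipode K h))) * rightConv ℓ Λ := by
  rw [← hΛ.rightConv_mulRight, ← hΛ.apply_antipode_mul hℓ, hΛ.rightConv_mulLeft]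

/-- If `z` is central, so is `S(z)`, and then `S²(z)` and `z` act in the same way on
`1 = ∑ f(Λ₍₁₎) Λ₍₂₎`. -/
lemma IsHaarIntegral.antipode_antipode_of_mem_center (hΛ : IsHaarIntegral K Λ) {z : H}
    (hz : ∀ x, z * x = x * z) : antipode K (antipode K z) = z := by
  have hSz (x : H) : antipode K z * x = x * antipode K z := by
    obtain ⟨y, rfl⟩ := hΛ.antipode_bijective.2 x
    rw [← antipode_mul_antidistrib, ← antipode_mul_antidistrib, hz]
  obtain ⟨f, hf⟩ := hΛ.slice_surjective 1
  rw [slice_apply] at hf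
  have h1 := hΛ.leftConv_mulLeft f z
  have h2 := hΛ.leftConv_mulRight f (antipode K z)
  have h3 : mulLeft K (antipode K z) = mulRight K (antipode K z) := by
    ext x; simp [hSz]
  rw [h3, h2, hf, one_mul, mul_one] at h1
  exact h1

/-- The trace formula `Tr(R_χ ∘ S²) = ℓ(1) χ(Λ)`. -/
lemma IsHaarIntegral.trace_rightConv (hΛ : IsHaarIntegral K Λ) (hℓ : leftConv ℓ Λ = 1)
    (χ : H →ₗ[K] K) :
    LinearMap.trace K H (rightConv χ ∘ₗ antipode K ∘ₗ antipode K) = ℓ 1 * χ Λ := by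
  have := hΛ.moduleFinite
  -- Expanding `S(h) = ∑ ℓ(Λ₍₁₎ h) Λ₍₂₎` writes `S R_χ S` as a sum of operators of rank one.
  have hS : antipode K ∘ₗ rightConv χ ∘ₗ antipode K = ∑ i ∈ (ℛ K Λ).index,
      (ℓ ∘ₗ mulLeft K ((ℛ K Λ).left i)).smulRight (antipode K (rightConv χ ((ℛ K Λ).right i))) := by
    ext h
    have h1 := hΛ.leftConv_mulRight ℓ h
    rw [hℓ, one_mul] at h1
    simp [← h1, leftConv_repr _ (ℛ K Λ)]
  have hm := congr(LinearMap.mul' K H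
    ((antipode K (A := H)).lTensor H $(congr($(comul_comp_rightConv χ) Λ))))
  rw [LinearMap.comp_apply, mul_antipode_lTensor_comul_apply, counit_rightConv,
    LinearMap.comp_apply, ← (ℛ K Λ).eq] at hm
  rw [← LinearMap.comp_assoc, LinearMap.trace_comp_comm', hS, map_sum]
  simp only [map_sum, LinearMap.lTensor_tmul, LinearMap.mul'_apply] at hm
  simp only [LinearMap.trace_smulRight, LinearMap.comp_apply, mulLeft_apply, ← map_sum, ← hm,
    Algebra.algebraMap_eq_smul_one, map_smul, smul_eq_mul, mul_comm]

/-- The antipode is an anti-morphism of coalgebras. -/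
lemma comul_antipode (h : H) : comul (R := K) (antipode K h) =
    TensorProduct.map (antipode K) (antipode K) (TensorProduct.comm K H H (comul h)) := by
  let G : H →ₗ[K] H ⊗[K] H :=
    TensorProduct.map (antipode K) (antipode K) ∘ₗ (TensorProduct.comm K H H).toLinearMap ∘ₗ comul
  suffices hG : WithConv.toConv G * WithConv.toConv (comul (R := K) (A := H)) = 1 from
    congr(WithConv.ofConv $(left_inv_eq_right_inv hG LinearMap.comul_right_inv) h).symm
  let Φ : H ⊗[K] (H ⊗[K] H) →ₗ[K] H ⊗[K] H := TensorProduct.lift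
    ((LinearMap.mul K (H ⊗[K] H)).compl₁₂ (TensorProduct.mk K H H 1 ∘ₗ antipode K)
      (TensorProduct.lift ((LinearMap.mul K (H ⊗[K] H)).compl₁₂
        ((TensorProduct.mk K H H).flip 1 ∘ₗ antipode K) comul)))
  have hΦ : Φ ∘ₗ (TensorProduct.assoc K H H H).toLinearMap ∘ₗ comul.rTensor H =
      TensorProduct.lift ((LinearMap.mul K (H ⊗[K] H)).compl₁₂ G comul) := by
    ext x y
    simp [Φ, G, ← (ℛ K x).eq, TensorProduct.sum_tmul, ← mul_assoc]
  ext x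
  have h1 := congr(Φ $(Coalgebra.coassoc_apply (R := K) x))
  have h2 := congr($hΦ (comul x))
  simp only [LinearMap.comp_apply, LinearEquiv.coe_coe] at h2
  rw [h2] at h1
  rw [LinearMap.convMul_def]
  have h3 : LinearMap.mul' K (H ⊗[K] H) ∘ₗ TensorProduct.map G comul =
      TensorProduct.lift ((LinearMap.mul K (H ⊗[K] H)).compl₁₂ G comul) := by
    ext; simp
  rw [← h3] at h1
  refine h1.trans ?_
  rw [← (ℛ K x).eq]
  have h4 (y : H) : ∑ i ∈ (ℛ K y).index, (antipode K ((ℛ K y).left i) ⊗ₜ[K] (1 : H)) *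
    comul (R := K) ((ℛ K y).right i) = 1 ⊗ₜ y := sum_antipode_tmul_one_mul_comul (ℛ K y)
  have h5 (y z : H) : Φ (y ⊗ₜ comul z) = 1 ⊗ₜ (antipode K y * z) := by
    have : Φ (y ⊗ₜ ∑ i ∈ (ℛ K z).index, (ℛ K z).left i ⊗ₜ (ℛ K z).right i) =
        1 ⊗ₜ (antipode K y * z) := by
      simp only [TensorProduct.tmul_sum, map_sum, Φ, TensorProduct.lift.tmul,
        LinearMap.compl₁₂_apply, LinearMap.comp_apply, LinearMap.mul_apply',
        TensorProduct.mk_apply, LinearMap.flip_apply, ← Finset.mul_sum, h4]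
      simp
    rwa [(ℛ K z).eq] at this
  simp only [map_sum, LinearMap.lTensor_tmul, h5]
  rw [← TensorProduct.tmul_sum, sum_antipode_mul_eq_algebraMap_counit]
  simp [LinearMap.convOne_def, Algebra.algebraMap_eq_smul_one,
    Algebra.TensorProduct.one_def]

lemma comul_antipode_antipode (h : H) : comul (R := K) (antipode K (antipode K h)) =
    TensorProduct.map (antipode K ∘ₗ antipode K) (antipode K ∘ₗ antipode K) (comul h) := by
  rw [comul_antipode, comul_antipode, ← (ℛ K h).eq]
  simp

end DualIntegral

/-! ### Traces of powers -/

section PowerTraces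

variable {K V : Type*} [Field K] [IsAlgClosed K] [AddCommGroup V] [Module K V]
  [FiniteDimensional K V]

/-- The eigenvalues of an endomorphism, listed with their algebraic multiplicities. -/
lemma exists_eigenvalue_family (f : Module.End K V) :
    ∃ (n : ℕ) (μ : Fin n → K),
      (∀ k : ℕ, LinearMap.trace K V (f ^ k) = ∑ i, μ i ^ k) ∧
      (∀ i, f.HasEigenvalue (μ i)) ∧ ∀ c, f.HasEigenvalue c → ∃ i, μ i = c := by
  classical
  have hds := DirectSum.isInternal_submodule_of_iSupIndep_of_iSup_eq_top
      f.independent_maxGenEigenspace f.iSup_maxGenEigenspace_eq_top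
  have hfin : {c | f.maxGenEigenspace c ≠ ⊥}.Finite :=
    WellFoundedGT.finite_ne_bot_of_iSupIndep f.independent_maxGenEigenspace
  have hmaps (c : K) := f.mapsTo_maxGenEigenspace_of_comm (Commute.refl f) c
  have hpow (k : ℕ) (c : K) :=
    f.mapsTo_maxGenEigenspace_of_comm (Commute.pow_right (Commute.refl f) k) c
  have hne (c : K) : f.maxGenEigenspace c ≠ ⊥ ↔ f.HasEigenvalue c := by
    rw [Module.End.hasEigenvalue_iff, not_iff_not]
    constructor
    · intro h
      exact eq_bot_iff.2 (h ▸ Module.End.eigenspace_le_maxGenEigenspace)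
    · intro h
      by_contra h'
      have := Module.End.hasEigenvalue_of_hasGenEigenvalue (f := f) (μ := c)
        (k := Module.finrank K V) (by
          change f.genEigenspace c (Module.finrank K V) ≠ ⊥
          rwa [← Module.End.maxGenEigenspace_eq_genEigenspace_finrank])
      exact (Module.End.hasEigenvalue_iff.1 this) h
  let ι := Σ c : hfin.toFinset, Fin (Module.finrank K (f.maxGenEigenspace c))
  let e : Fin (Fintype.card ι) ≃ ι := (Fintype.equivFin ι).symm
  refine ⟨Fintype.card ι, fun i ↦ (e i).1, fun k ↦ ?_,
    fun i ↦ (hne _).1 (hfin.mem_toFinset.1 (e i).1.2), fun c hc ↦ ?_⟩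
  · rw [e.sum_comp fun i : ι ↦ (i.1 : K) ^ k,
      LinearMap.trace_eq_sum_trace_restrict' hds hfin (hpow k), Fintype.sum_sigma,
      ← Finset.sum_coe_sort]
    refine Finset.sum_congr rfl fun c _ ↦ ?_
    refine Eq.trans ?_ (Finset.sum_const ((c : K) ^ k)).symm
    rw [Finset.card_univ, Fintype.card_fin]
    have hrestr : (f ^ k).restrict (hpow k c) = (f.restrict (hmaps c)) ^ k :=
      (Module.End.pow_restrict k (hmaps c)).symm
    rw [hrestr]
    clear hrestr
    induction k with
    | zero => simp
    | succ k ih =>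
      rw [pow_succ, Module.End.mul_eq_comp,
        LinearMap.trace_comp_eq_mul_of_commute_of_isNilpotent (c : K)
          (Commute.pow_left (Commute.refl _) k)
          (f.isNilpotent_restrict_maxGenEigenspace_sub_algebraMap c), ih]
      rw [mul_smul_comm, pow_succ']
  · have hpos : 0 < Module.finrank K (f.maxGenEigenspace c) := by
      have := (Submodule.nontrivial_iff_ne_bot).2 ((hne c).2 hc)
      exact Module.finrank_pos
    exact ⟨e.symm ⟨⟨c, by simpa using (hne c).2 hc⟩, ⟨0, hpos⟩⟩, by simp⟩

end PowerTraces

/-! ### Traces of automorphisms of finite order -/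

section Positivity

lemma trace_mulLeft_comp_mulRight {K V : Type*} [CommRing K] [AddCommGroup V] [Module K V]
    [Module.Free K V] [Module.Finite K V] (f g : Module.End K V) :
    LinearMap.trace K (Module.End K V) (mulLeft K f ∘ₗ mulRight K g) =
      LinearMap.trace K V f * LinearMap.trace K V g := by
  have : mulLeft K f ∘ₗ mulRight K g = (dualTensorHomEquiv K V V).conj
      (TensorProduct.map (Module.Dual.transpose (R := K) g) f) := by
    ext1 x
    obtain ⟨x, rfl⟩ := (dualTensorHomEquiv K V V).surjective x
    rw [LinearEquiv.conj_apply_apply, LinearEquiv.symm_apply_apply]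
    induction x with
    | zero => simp
    | add x y hx hy => simp only [map_add, hx, hy]
    | tmul x y => ext v; simp [Module.Dual.transpose]
  rw [this]
  refine (LinearMap.trace_conj' (R := K) (M := Module.Dual K V ⊗[K] V)
    (N := V →ₗ[K] V) _ (dualTensorHomEquiv K V V)).trans ?_
  rw [LinearMap.trace_tensorProduct', LinearMap.trace_transpose', mul_comm]

lemma trace_pi {K : Type*} [Field K] {ι : Type*} [Fintype ι] {M : ι → Type*}
    [∀ i, AddCommGroup (M i)] [∀ i, Module K (M i)] [∀ i, FiniteDimensional K (M i)]
    (t : ∀ i, Module.End K (M i)) :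
    LinearMap.trace K (∀ i, M i) (LinearMap.pi fun i ↦ t i ∘ₗ LinearMap.proj i) =
      ∑ i, LinearMap.trace K (M i) (t i) := by
  classical
  have : LinearMap.pi (fun i ↦ t i ∘ₗ LinearMap.proj i) =
      ∑ i, LinearMap.single K M i ∘ₗ (t i ∘ₗ LinearMap.proj i) := by
    ext i x j
    simp [Finset.sum_apply]
  rw [this, map_sum]
  refine Finset.sum_congr rfl fun i _ ↦ ?_
  rw [LinearMap.trace_comp_comm', LinearMap.comp_assoc]
  congr 1
  ext x
  simp

variable {K : Type*} [Field K] [IsAlgClosed K] [CharZero K]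

/-- For an embedding `φ` of the algebraic numbers of `K` into `ℂ`, the traces of an automorphism
of finite order and of its inverse are complex conjugate. -/
lemma exists_trace_conj (φ : algebraicClosure ℚ K →+* ℂ) {V : Type*} [AddCommGroup V]
    [Module K V] [FiniteDimensional K V] {f : Module.End K V} {n : ℕ} (hf : f ^ (n + 1) = 1) :
    ∃ u v : algebraicClosure ℚ K, (u : K) = LinearMap.trace K V f ∧
      (v : K) = LinearMap.trace K V (f ^ n) ∧ φ v = starRingEnd ℂ (φ u) := by
  obtain ⟨m, μ, htr, hμ, -⟩ := exists_eigenvalue_family f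
  have hroot (i : Fin m) : μ i ^ (n + 1) = 1 := by
    obtain ⟨v, hv⟩ := (hμ i).exists_hasEigenvector
    have := hv.pow_apply (n + 1)
    rw [hf, Module.End.one_apply] at this
    have h2 : (1 - μ i ^ (n + 1)) • v = 0 := by rw [sub_smul, one_smul, ← this, sub_self]
    exact (sub_eq_zero.1 ((smul_eq_zero.1 h2).resolve_right hv.2)).symm
  have halg (i : Fin m) : μ i ∈ algebraicClosure ℚ K := by
    rw [mem_algebraicClosure_iff]
    refine ⟨Polynomial.X ^ (n + 1) - 1, Polynomial.X_pow_sub_C_ne_zero n.succ_pos 1, ?_⟩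
    simp [hroot i]
  let ν (i : Fin m) : algebraicClosure ℚ K := ⟨μ i, halg i⟩
  have hν (i : Fin m) : ν i ^ (n + 1) = 1 := Subtype.ext (by simpa [ν] using hroot i)
  refine ⟨∑ i, ν i, ∑ i, ν i ^ n, ?_, ?_, ?_⟩
  · simpa [ν] using (htr 1).symm
  · simpa [ν] using (htr n).symm
  · simp only [map_sum, map_pow]
    refine Finset.sum_congr rfl fun i _ ↦ ?_
    have h1 : φ (ν i) ^ (n + 1) = 1 := by rw [← map_pow, hν, map_one]
    rw [← Complex.inv_eq_conj (Complex.norm_eq_one_of_pow_eq_one h1 n.succ_ne_zero)]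
    exact eq_inv_of_mul_eq_one_left (by rw [← pow_succ, h1])

/-- An automorphism of finite order of a matrix algebra is conjugation by some `g` of finite
order, and its trace is `tr(g) tr(g⁻¹)`, hence nonnegative. -/
lemma exists_trace_nonneg (φ : algebraicClosure ℚ K →+* ℂ) {V : Type*} [AddCommGroup V]
    [Module K V] [FiniteDimensional K V] [Nontrivial V]
    (τ : Module.End K V ≃ₐ[K] Module.End K V) {n : ℕ} (hτ : τ ^ (n + 1) = 1) :
    ∃ (w : algebraicClosure ℚ K) (r : ℝ), (w : K) = LinearMap.trace K _ τ.toLinearMap ∧ 0 ≤ r ∧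
      φ w = r := by
  obtain ⟨T, rfl⟩ := τ.eq_linearEquivConjAlgEquiv
  set τ := T.conjAlgEquiv K with hτdef
  let g : Module.End K V := T.toLinearMap
  have hmul (x : Module.End K V) : τ x * g = g * x := by
    ext v; simp [hτdef, g, LinearEquiv.conjAlgEquiv_apply]
  have hpow (k : ℕ) (x : Module.End K V) : (τ ^ k) x * g ^ k = g ^ k * x := by
    induction k generalizing x with
    | zero => simp
    | succ k ih =>
      rw [pow_succ, AlgEquiv.mul_apply, pow_succ, ← mul_assoc, ih, mul_assoc, hmul, mul_assoc]
  have hcenter : g ^ (n + 1) ∈ Subalgebra.center K (Module.End K V) := by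
    rw [Subalgebra.mem_center_iff]
    intro x
    rw [← hpow, hτ, AlgEquiv.one_apply]
  rw [Algebra.IsCentral.center_eq_bot, Algebra.mem_bot] at hcenter
  obtain ⟨c, hc⟩ := hcenter
  have hunit : IsUnit (g ^ (n + 1)) :=
    ((Module.End.isUnit_iff g).2 T.bijective).pow _
  have hc0 : c ≠ 0 := by
    rintro rfl
    rw [← hc, map_zero] at hunit
    exact not_isUnit_zero hunit
  obtain ⟨d, hd⟩ := IsAlgClosed.exists_pow_nat_eq c n.succ_pos
  have hd0 : d ≠ 0 := by
    rintro rfl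
    exact hc0 (by rw [← hd, zero_pow n.succ_ne_zero])
  -- Rescaling `g` does not change the conjugation.
  let g' : Module.End K V := d⁻¹ • g
  have hg' : g' ^ (n + 1) = 1 := by
    rw [smul_pow, ← hc, ← hd, inv_pow, Algebra.algebraMap_eq_smul_one, smul_smul,
      inv_mul_cancel₀ (pow_ne_zero _ hd0), one_smul]
  have hτg : τ.toLinearMap = mulLeft K g' ∘ₗ mulRight K (g' ^ n) := by
    ext1 x
    have h1 : τ x * g' = g' * x := by simp [g', hmul]
    calc τ x = τ x * (g' * g' ^ n) := by rw [← pow_succ', hg', mul_one]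
      _ = g' * (x * g' ^ n) := by rw [← mul_assoc, h1, mul_assoc]
  obtain ⟨u, v, hu, hv, huv⟩ := exists_trace_conj φ hg'
  refine ⟨u * v, Complex.normSq (φ u), ?_, Complex.normSq_nonneg _, ?_⟩
  · rw [hτg, trace_mulLeft_comp_mulRight, ← hu, ← hv]
    rfl
  · rw [map_mul, huv, Complex.mul_conj]

lemma nonempty_algebraicClosure_ringHom_complex (K : Type*) [Field K] [CharZero K] :
    Nonempty (algebraicClosure ℚ K →+* ℂ) := by
  have : Algebra.IsAlgebraic ℚ (algebraicClosure ℚ K) := by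
    convert algebraicClosure.isAlgebraic ℚ K
    all_goals rfl
  exact ⟨(IsAlgClosed.lift : _ →ₐ[ℚ] ℂ).toRingHom⟩

/-- An automorphism of finite order of a semisimple algebra that fixes the center and an
augmentation has nonzero trace: each block contributes a nonnegative number, and the
one-dimensional block of the augmentation contributes `1`. -/
lemma trace_algEquiv_ne_zero {A : Type*} [Ring A] [Algebra K A] [FiniteDimensional K A]
    [IsSemisimpleRing A] (ε : A →ₐ[K] K) (σ : A ≃ₐ[K] A) {n : ℕ} (hσ : σ ^ (n + 1) = 1)
    (hε : ∀ x, ε (σ x) = ε x) (hcenter : ∀ z ∈ Subalgebra.center K A, σ z = z) :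
    LinearMap.trace K A σ.toLinearMap ≠ 0 := by
  classical
  obtain ⟨r, d, hd, ⟨e⟩⟩ := IsSemisimpleRing.exists_algEquiv_pi_matrix_of_isAlgClosed K A
  let ι (i : Fin r) (x : Matrix (Fin (d i)) (Fin (d i)) K) : A := e.symm (Pi.single i x)
  have hιmul (i) (x y) : ι i (x * y) = ι i x * ι i y := by
    simp only [ι, ← map_mul, Pi.single_mul]
  have hιe (i) (x) (y : A) : ι i x * y = ι i (x * e y i) := by
    apply e.injective
    simp only [ι, map_mul, AlgEquiv.apply_symm_apply]
    ext j : 1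
    by_cases h : j = i
    · subst h; simp
    · simp [h]
  have hyι (i) (x) (y : A) : y * ι i x = ι i (e y i * x) := by
    apply e.injective
    simp only [ι, map_mul, AlgEquiv.apply_symm_apply]
    ext j : 1
    by_cases h : j = i
    · subst h; simp
    · simp [h]
  have hσι1 (i) : σ (ι i 1) = ι i 1 := by
    refine hcenter _ (Subalgebra.mem_center_iff.2 fun y ↦ ?_)
    rw [hιe, hyι, one_mul, mul_one]
  have hιinj (i) : Function.Injective (ι i) :=
    fun x y h ↦ Pi.single_injective i (e.symm.injective h)
  let τ (i : Fin r) : Module.End K (Matrix (Fin (d i)) (Fin (d i)) K) :=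
    LinearMap.proj i ∘ₗ e.toLinearMap ∘ₗ σ.toLinearMap ∘ₗ e.symm.toLinearMap ∘ₗ
      LinearMap.single K (fun i ↦ Matrix (Fin (d i)) (Fin (d i)) K) i
  have hτ (i) (x) : τ i x = e (σ (ι i x)) i := rfl
  have hστ (i) (x) : σ (ι i x) = ι i (τ i x) := by
    calc σ (ι i x) = σ (ι i x) * ι i 1 := by rw [← hσι1, ← map_mul, ← hιmul, mul_one]
      _ = ι i (τ i x) := by rw [hyι, mul_one, hτ]
  have hτ1 (i) : τ i 1 = 1 := hιinj i (by rw [← hστ, hσι1])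
  have hτmul (i) (x y) : τ i (x * y) = τ i x * τ i y :=
    hιinj i (by rw [← hστ, hιmul, map_mul, hστ, hστ, hιmul])
  have hpow (i) (k : ℕ) (x) : (σ ^ k) (ι i x) = ι i ((τ i ^ k) x) := by
    induction k generalizing x with
    | zero => simp
    | succ k ih => rw [pow_succ, AlgEquiv.mul_apply, hστ, ih, pow_succ, Module.End.mul_apply]
  have hτpow (i) : τ i ^ (n + 1) = 1 := by
    ext1 x
    exact hιinj i (by rw [← hpow, hσ]; simp)
  have htrace : LinearMap.trace K A σ.toLinearMap = ∑ i, LinearMap.trace K _ (τ i) := by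
    rw [← trace_pi, ← LinearMap.trace_conj' _ e.toLinearEquiv]
    congr 1
    refine LinearMap.ext fun f ↦ funext fun i ↦ ?_
    change e (σ (e.symm f)) i = τ i (f i)
    have h1 : σ (e.symm f) * ι i 1 = σ (ι i (f i)) := by
      rw [← hσι1, ← map_mul, hyι, AlgEquiv.apply_symm_apply, mul_one]
    rw [hτ, ← h1, map_mul]
    simp [ι]
  obtain ⟨φ⟩ := nonempty_algebraicClosure_ringHom_complex K
  have hnonneg (i) : ∃ (w : algebraicClosure ℚ K) (r : ℝ),
      (w : K) = LinearMap.trace K _ (τ i) ∧ 0 ≤ r ∧ φ w = r := by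
    have := hd i
    have hbij : Function.Bijective (AlgHom.ofLinearMap (τ i) (hτ1 i) (hτmul i)) := by
      refine Function.bijective_iff_has_inverse.2 ⟨fun x ↦ (τ i ^ n) x, fun x ↦ ?_, fun x ↦ ?_⟩
      · exact congr($((pow_succ (τ i) n).symm.trans (hτpow i)) x)
      · exact congr($((pow_succ' (τ i) n).symm.trans (hτpow i)) x)
    let τ' := AlgEquiv.ofBijective _ hbij
    have hτ' : τ' ^ (n + 1) = 1 := by
      have (k : ℕ) (x) : (τ' ^ k) x = (τ i ^ k) x := by
        induction k generalizing x with
        | zero => simp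
        | succ k ih =>
          rw [pow_succ, pow_succ, AlgEquiv.mul_apply, Module.End.mul_apply, ih]; rfl
      ext1 x
      rw [this, hτpow]; rfl
    let E : Matrix (Fin (d i)) (Fin (d i)) K ≃ₐ[K] Module.End K (Fin (d i) → K) :=
      Matrix.toLinAlgEquiv'
    obtain ⟨w, r, hw, hr, hwr⟩ := exists_trace_nonneg φ (AlgEquiv.autCongr E τ') (n := n)
      (by rw [← map_pow, hτ', map_one])
    refine ⟨w, r, hw.trans ?_, hr, hwr⟩
    exact LinearMap.trace_conj' (τ i) E.toLinearEquiv
  choose w r' hw hr hwr using hnonneg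
  intro h0
  rw [htrace] at h0
  have hw0 : ∑ i, w i = 0 := by
    apply Subtype.ext
    simpa [hw] using h0
  have hr0 : ∑ i, r' i = 0 := by
    have := congr(φ $hw0)
    rw [map_sum, map_zero] at this
    simp only [hwr] at this
    exact_mod_cast this
  have hall (i) : LinearMap.trace K _ (τ i) = 0 := by
    have h1 := (Finset.sum_eq_zero_iff_of_nonneg fun i _ ↦ hr i).1 hr0 i (Finset.mem_univ i)
    have h2 : φ (w i) = 0 := by rw [hwr, h1, Complex.ofReal_zero]
    rw [← hw, (map_eq_zero φ).1 h2]; rfl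
  -- On the block where the augmentation is nonzero, `τ i` is the identity.
  obtain ⟨i, hi⟩ : ∃ i, ε (ι i 1) ≠ 0 := by
    by_contra! h
    have h1 : ∑ i, ι i 1 = 1 := by
      simp only [ι, ← map_sum]
      change e.symm (∑ i, Pi.single i ((1 : ∀ i, Matrix (Fin (d i)) (Fin (d i)) K) i)) = 1
      rw [Finset.univ_sum_single (1 : ∀ i, Matrix (Fin (d i)) (Fin (d i)) K), map_one]
    have := congr(ε $h1)
    rw [map_sum, map_one] at this
    simp [h] at this
  have := hd i
  have hε1 : ε (ι i 1) = 1 := by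
    have h1 := congr(ε $(hιmul i 1 1))
    rw [mul_one, map_mul] at h1
    exact (mul_right_eq_self₀.1 h1.symm).resolve_right hi
  let ε' : Matrix (Fin (d i)) (Fin (d i)) K →+* K :=
    { toFun := fun x ↦ ε (ι i x)
      map_one' := hε1
      map_mul' := fun x y ↦ by rw [hιmul, map_mul]
      map_zero' := by simp [ι]
      map_add' := fun x y ↦ by simp [ι, Pi.single_add] }
  have hid : τ i = LinearMap.id := by
    ext1 x
    apply ε'.injective
    change ε (ι i (τ i x)) = ε (ι i x)
    rw [← hστ, hε]
  have h1 := hall i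
  rw [hid, LinearMap.trace_id, Nat.cast_eq_zero] at h1
  exact Module.finrank_pos.ne' h1

end Positivity

/-! ### Endomorphisms with integral trace -/

section IntegerTraces

variable {K V : Type*} [Field K] [AddCommGroup V] [Module K V]
  [FiniteDimensional K V]

lemma trace_of_isIdempotentElem {f : Module.End K V} (hf : IsIdempotentElem f) :
    LinearMap.trace K V f = Module.finrank K (LinearMap.range f) :=
  (LinearMap.IsIdempotentElem.isProj_range f hf).trace

/-- An endomorphism with `f³ = f` has its eigenvalues in `{0, 1, -1}` and integral trace. -/
lemma exists_trace_eq_intCast [CharZero K] {f : Module.End K V} (hf : f * f * f = f) :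
    ∃ z : ℤ, LinearMap.trace K V f = z := by
  -- `f` is the difference of the idempotents `(f² + f) / 2` and `(f² - f) / 2`.
  have h4 : f * f * (f * f) = f * f := by rw [← mul_assoc, hf]
  have h3 : f * (f * f) = f := by rw [← mul_assoc, hf]
  have hp : IsIdempotentElem ((1 / 2 : K) • (f * f + f)) := by
    rw [IsIdempotentElem, smul_mul_smul_comm, mul_add, add_mul, add_mul, h4, h3, hf]
    module
  have hm : IsIdempotentElem ((1 / 2 : K) • (f * f - f)) := by
    rw [IsIdempotentElem, smul_mul_smul_comm, mul_sub, sub_mul, sub_mul, h4, h3, hf]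
    module
  refine ⟨Module.finrank K (LinearMap.range ((1 / 2 : K) • (f * f + f))) -
    Module.finrank K (LinearMap.range ((1 / 2 : K) • (f * f - f))), ?_⟩
  push_cast
  rw [← trace_of_isIdempotentElem hp, ← trace_of_isIdempotentElem hm, ← map_sub]
  congr 1
  module

/-- An involution with nonzero trace divisible by the dimension is `±1`. -/
lemma eq_one_or_eq_neg_one_of_trace [CharZero K] {f : Module.End K V} (hf : f * f = 1) {z : ℤ}
    (h0 : LinearMap.trace K V f ≠ 0) (hz : LinearMap.trace K V f = Module.finrank K V * z) :
    f = 1 ∨ f = -1 := by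
  set P : Module.End K V := (1 / 2 : K) • (1 + f) with hP
  have hPid : IsIdempotentElem P := by
    rw [IsIdempotentElem, hP, smul_mul_smul_comm, mul_add, add_mul, add_mul, hf, one_mul, mul_one,
      one_mul]
    module
  have hPf : f = (2 : K) • P - 1 := by rw [hP]; module
  have htr := trace_of_isIdempotentElem hPid
  have hle := Submodule.finrank_le (LinearMap.range P)
  set p := Module.finrank K (LinearMap.range P)
  set n := Module.finrank K V with hn
  have htf : LinearMap.trace K V f = 2 * p - n := by
    rw [hPf, map_sub, map_smul, htr, LinearMap.trace_one, smul_eq_mul]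
  have hint : (2 * p - n : ℤ) = n * z := by
    rw [hz] at htf
    exact_mod_cast htf.symm
  have hne : (2 * p - n : ℤ) ≠ 0 := by
    intro h
    apply h0
    rw [htf]
    exact_mod_cast congr((($h : ℤ) : K))
  have hpn : p = n ∨ p = 0 := by
    have hz0 : z ≠ 0 := by
      rintro rfl
      exact hne (by rw [hint, mul_zero])
    rcases lt_or_gt_of_ne hz0 with h | h
    · right
      have : (n : ℤ) * z ≤ n * (-1) := by gcongr; omega
      omega
    · left
      have : (n : ℤ) * 1 ≤ n * z := by gcongr; omega
      omega
  rcases hpn with h | h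
  · left
    have h1 : (1 - P : Module.End K V) = 0 := by
      refine (LinearMap.IsIdempotentElem.trace_eq_zero_iff hPid.one_sub).1 ?_
      rw [map_sub, htr, LinearMap.trace_one, h, sub_self]
    rw [hPf, ← sub_eq_zero.1 h1]
    module
  · right
    have h1 : P = 0 := by
      refine (LinearMap.IsIdempotentElem.trace_eq_zero_iff hPid).1 ?_
      rw [htr, h, Nat.cast_zero]
    rw [hPf, h1, smul_zero, zero_sub]

end IntegerTraces

/-! ### The regular character -/

section RegularCharacter

variable {K H : Type*} [Field K] [Ring H] [HopfAlgebra K H]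

/-- The character of the left regular representation. -/
def regChar (K H : Type*) [Field K] [Ring H] [Algebra K H] : H →ₗ[K] K :=
  LinearMap.trace K H ∘ₗ LinearMap.mul K H

lemma regChar_apply (h : H) : regChar K H h = LinearMap.trace K H (mulLeft K h) := rfl

/-- The map `x ⊗ y ↦ Δ(x) (1 ⊗ y)` is an isomorphism of `H ⊗ H`, with the action of `H` on the
left factor alone, onto `H ⊗ H` with the diagonal action. -/
def diagonalMap (K H : Type*) [Field K] [Ring H] [HopfAlgebra K H] : H ⊗[K] H →ₗ[K] H ⊗[K] H :=
  TensorProduct.lift ((LinearMap.mul K (H ⊗[K] H)).compl₁₂ comul (TensorProduct.mk K H H 1))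

lemma diagonalMap_tmul (x y : H) :
    diagonalMap K H (x ⊗ₜ y) = comul (R := K) x * (1 ⊗ₜ y) := rfl

lemma diagonalMap_bijective [FiniteDimensional K H] :
    Function.Bijective (diagonalMap K H) := by
  have hsurj : Function.Surjective (diagonalMap K H) := by
    rw [← LinearMap.range_eq_top, eq_top_iff, ← TensorProduct.span_tmul_eq_top, Submodule.span_le]
    rintro _ ⟨x, y, rfl⟩
    refine ⟨∑ i ∈ (ℛ K x).index, (ℛ K x).left i ⊗ₜ (antipode K ((ℛ K x).right i) * y), ?_⟩
    have := congr($(sum_comul_mul_one_tmul_antipode (ℛ K x)) * ((1 : H) ⊗ₜ[K] y))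
    simp only [Finset.sum_mul, mul_assoc, Algebra.TensorProduct.tmul_mul_tmul, one_mul,
      mul_one] at this
    simp [diagonalMap_tmul, this]
  exact ⟨LinearMap.injective_iff_surjective.2 hsurj, hsurj⟩

/-- The regular character `χ` satisfies `χ * χ = dim(H) χ` in the dual algebra, because
`H ⊗ H` with the diagonal action is a sum of `dim H` copies of `H`. -/
lemma regChar_comp_rightConv [FiniteDimensional K H] :
    regChar K H ∘ₗ rightConv (regChar K H) = (Module.finrank K H : K) • regChar K H := by
  ext h
  have h1 : LinearMap.trace K (H ⊗[K] H) (mulLeft K (comul (R := K) h)) =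
      regChar K H (rightConv (regChar K H) h) := by
    have hmul : mulLeft K (comul (R := K) h) = ∑ i ∈ (ℛ K h).index,
        TensorProduct.map (mulLeft K ((ℛ K h).left i)) (mulLeft K ((ℛ K h).right i)) := by
      ext1
      ext x y
      simp [← (ℛ K h).eq, Finset.sum_mul]
    rw [hmul, map_sum, rightConv_repr _ (ℛ K h), map_sum]
    refine Finset.sum_congr rfl fun i _ ↦ ?_
    rw [LinearMap.trace_tensorProduct', map_smul, smul_eq_mul, mul_comm]
    rfl
  let e : H ⊗[K] H ≃ₗ[K] H ⊗[K] H := LinearEquiv.ofBijective _ diagonalMap_bijective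
  have h2 : mulLeft K (comul (R := K) h) =
      e.conj (TensorProduct.map (mulLeft K h) LinearMap.id) := by
    refine LinearMap.ext fun t ↦ ?_
    obtain ⟨t, rfl⟩ := e.surjective t
    rw [LinearEquiv.conj_apply_apply, LinearEquiv.symm_apply_apply]
    induction t with
    | zero => simp
    | add x y hx hy => simp only [map_add, hx, hy]
    | tmul x y =>
      change comul (R := K) h * (comul x * (1 ⊗ₜ y)) = comul (h * x) * (1 ⊗ₜ y)
      rw [Bialgebra.comul_mul, mul_assoc]
  rw [LinearMap.comp_apply, ← h1, h2, LinearMap.trace_conj', LinearMap.trace_tensorProduct',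
    LinearMap.trace_id, mul_comm]
  rfl

lemma IsHaarIntegral.regChar_eq_one [FiniteDimensional K H] {Λ : H} (hΛ : IsHaarIntegral K Λ) :
    regChar K H Λ = 1 := by
  have : mulLeft K Λ = (counit (R := K)).smulRight Λ := by
    ext x
    simp [hΛ.mul_right]
  rw [regChar_apply, this, LinearMap.trace_smulRight, hΛ.counit_eq]

end RegularCharacter

/-! ### The antipode is an involution -/

section AntipodeSquared

variable {K H : Type*} [Field K] [Ring H] [HopfAlgebra K H]

variable {Λ : H}

/-- The square of the antipode, as an automorphism of algebras. -/
def IsHaarIntegral.antipodeSq (hΛ : IsHaarIntegral K Λ) : H ≃ₐ[K] H :=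
  AlgEquiv.ofBijective (AlgHom.ofLinearMap (antipode K ∘ₗ antipode K) (by simp [antipode_one])
    (by simp [antipode_mul_antidistrib])) (hΛ.antipode_bijective.comp hΛ.antipode_bijective)

lemma IsHaarIntegral.antipodeSq_apply (hΛ : IsHaarIntegral K Λ) (h : H) :
    hΛ.antipodeSq h = antipode K (antipode K h) := rfl

lemma IsHaarIntegral.exists_antipodeSq_pow_eq_one (hΛ : IsHaarIntegral K Λ) :
    ∃ n : ℕ, hΛ.antipodeSq ^ (n + 1) = 1 := by
  have := hΛ.moduleFinite
  obtain ⟨ℓ, hℓ⟩ := hΛ.slice_surjective 1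
  let a : GroupLike K H := ⟨rightConv ℓ Λ, hΛ.isGroupLikeElem hℓ⟩
  have hfin : Finite (GroupLike K H) :=
    (linearIndep_groupLikeVal (R := K) (A := H)).finite
  have ha : (a : H) ^ Nat.card (GroupLike K H) = 1 := by
    rw [← GroupLike.val_pow, pow_card_eq_one', GroupLike.val_one]
  have hpow (k : ℕ) (h : H) :
      ((hΛ.antipodeSq ^ 2) ^ k) h * (a : H) ^ k = (a : H) ^ k * h := by
    induction k generalizing h with
    | zero => simp
    | succ k ih =>
      have h4 : (a : H) * h = (hΛ.antipodeSq ^ 2) h * a := hΛ.antipode_pow_four hℓ h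
      rw [pow_succ (hΛ.antipodeSq ^ 2), AlgEquiv.mul_apply, pow_succ (a : H), ← mul_assoc, ih,
        mul_assoc, ← h4, mul_assoc]
  have hpos : 0 < Nat.card (GroupLike K H) := Nat.card_pos
  refine ⟨2 * Nat.card (GroupLike K H) - 1, ?_⟩
  rw [Nat.sub_add_cancel (by omega), pow_mul]
  ext h
  simpa [ha] using hpow (Nat.card (GroupLike K H)) h

lemma rightConv_comp_antipode_antipode {χ : H →ₗ[K] K}
    (hχ : ∀ h, χ (antipode K (antipode K h)) = χ h) :
    rightConv χ ∘ₗ (antipode K ∘ₗ antipode K) = (antipode K ∘ₗ antipode K) ∘ₗ rightConv χ := by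
  ext h
  simp [rightConv_apply, comul_antipode_antipode, ← (ℛ K h).eq, hχ]

lemma IsHaarIntegral.regChar_antipodeSq [FiniteDimensional K H] (hΛ : IsHaarIntegral K Λ) (h : H) :
    regChar K H (antipode K (antipode K h)) = regChar K H h := by
  rw [← hΛ.antipodeSq_apply, regChar_apply, regChar_apply,
    ← LinearMap.trace_conj' (mulLeft K h) hΛ.antipodeSq.toLinearEquiv]
  congr 1
  ext x
  simp

/-- The theorem of Larson and Radford: the antipode of a semisimple Hopf algebra over an
algebraically closed field of characteristic zero is an involution. -/
theorem IsHaarIntegral.antipode_antipode [IsAlgClosed K] [CharZero K] [IsSemisimpleRing H]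
    (hΛ : IsHaarIntegral K Λ) (h : H) : antipode K (antipode K h) = h := by
  have := hΛ.moduleFinite
  have hnt : Nontrivial H := ⟨1, 0, fun h ↦ by
    simpa using congr(counit (R := K) $h)⟩
  obtain ⟨ℓ, hℓ⟩ := hΛ.slice_surjective 1
  rw [slice_apply] at hℓ
  have htrace : LinearMap.trace K H (antipode K ∘ₗ antipode K) = ℓ 1 := by
    have := hΛ.trace_rightConv hℓ (counit (R := K))
    rwa [rightConv_counit, LinearMap.id_comp, hΛ.counit_eq, mul_one] at this
  obtain ⟨n, hn⟩ := hΛ.exists_antipodeSq_pow_eq_one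
  have hne : LinearMap.trace K H (antipode K ∘ₗ antipode K) ≠ 0 :=
    trace_algEquiv_ne_zero (Bialgebra.counitAlgHom K H) hΛ.antipodeSq hn
      (fun x ↦ by simp [hΛ.antipodeSq_apply]) fun z hz ↦
      hΛ.antipode_antipode_of_mem_center fun x ↦ (Subalgebra.mem_center_iff.1 hz x).symm
  -- Hence `ℓ(1) ≠ 0`, the distinguished group-like element is `1`, and `S⁴ = 1`.
  have ha : rightConv ℓ Λ = 1 := by
    have := hΛ.rightConv_eq hℓ 1
    rw [rightConv_one] at this
    exact (smul_right_injective H (htrace ▸ hne) this).symm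
  have hS4 : (antipode K ∘ₗ antipode K : Module.End K H) * (antipode K ∘ₗ antipode K) = 1 := by
    ext x
    have := hΛ.antipode_pow_four hℓ x
    rw [ha, one_mul, mul_one] at this
    exact this.symm
  have hn0 : (Module.finrank K H : K) ≠ 0 := Nat.cast_ne_zero.2 Module.finrank_pos.ne'
  -- The idempotent `e = χ / n` of `H*`, for the regular character `χ`.
  let e : H →ₗ[K] K := (Module.finrank K H : K)⁻¹ • regChar K H
  have hRe : rightConv e = (Module.finrank K H : K)⁻¹ • rightConv (regChar K H) := by
    ext x
    simp [e, rightConv_apply, LinearMap.lTensor_smul]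
  have hid : rightConv e * rightConv e = rightConv e := by
    rw [Module.End.mul_eq_comp, ← rightConv_comp]
    congr 1
    rw [hRe, LinearMap.comp_smul, LinearMap.smul_comp, regChar_comp_rightConv, smul_smul,
      smul_smul, mul_assoc, inv_mul_cancel₀ hn0, mul_one]
  have hcomm : rightConv e * (antipode K ∘ₗ antipode K) =
      (antipode K ∘ₗ antipode K) * rightConv e :=
    rightConv_comp_antipode_antipode fun h ↦ by simp [e, hΛ.regChar_antipodeSq]
  obtain ⟨z, hz⟩ := exists_trace_eq_intCast (f := rightConv e * (antipode K ∘ₗ antipode K)) (by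
    have h1 : rightConv e * (antipode K ∘ₗ antipode K) *
        (rightConv e * (antipode K ∘ₗ antipode K)) = rightConv e := by
      rw [mul_assoc, ← mul_assoc (antipode K ∘ₗ antipode K), ← hcomm, mul_assoc, hS4, mul_one, hid]
    rw [h1, ← mul_assoc, hid])
  have htr : LinearMap.trace K H (rightConv e * (antipode K ∘ₗ antipode K)) =
      LinearMap.trace K H (antipode K ∘ₗ antipode K) * (Module.finrank K H : K)⁻¹ := by
    rw [htrace]
    refine (hΛ.trace_rightConv hℓ e).trans ?_
    simp [e, hΛ.regChar_eq_one]
  have hz' : LinearMap.trace K H (antipode K ∘ₗ antipode K) = Module.finrank K H * z := by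
    rw [← hz, htr]
    field_simp
  rcases eq_one_or_eq_neg_one_of_trace hS4 hne hz' with h1 | h1
  · exact congr($h1 h)
  · exfalso
    have h2 : antipode K (antipode K (1 : H)) = -1 := congr($h1 1)
    rw [antipode_one, antipode_one] at h2
    have h3 : (2 : K) • (1 : H) = 0 := by
      rw [two_smul]; nth_rw 1 [h2]; simp
    exact one_ne_zero ((smul_eq_zero.1 h3).resolve_left two_ne_zero)

/-- As `S² = 1`, the trace of `h ↦ ∑ h₍₁₎ χ(h₍₂₎)` is `dim(H) χ(Λ)`. -/
theorem IsHaarIntegral.trace_rightConv_eq [IsAlgClosed K] [CharZero K] [IsSemisimpleRing H]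
    (hΛ : IsHaarIntegral K Λ) (χ : H →ₗ[K] K) :
    LinearMap.trace K H (rightConv χ) = Module.finrank K H * χ Λ := by
  have := hΛ.moduleFinite
  obtain ⟨ℓ, hℓ⟩ := hΛ.slice_surjective 1
  have hS : (antipode K (A := H)) ∘ₗ antipode K = LinearMap.id := by
    ext x
    exact hΛ.antipode_antipode x
  have h1 := hΛ.trace_rightConv hℓ
  rw [hS] at h1
  simp only [LinearMap.comp_id] at h1
  have h2 := h1 (counit (R := K))
  rw [rightConv_counit, LinearMap.trace_id, hΛ.counit_eq, mul_one] at h2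
  rw [h1, h2]

end AntipodeSquared

/-! ### Power sums -/

section PowerSums

variable {K : Type*} [Field K] [CharZero K] {n : ℕ}

/-- In characteristic zero, the first `n` power sums of `n` elements do not all vanish unless all
the elements are zero. -/
lemma exists_psum_ne_zero (μ : Fin n → K) {i₀ : Fin n} (hi₀ : μ i₀ ≠ 0) :
    ∃ k : ℕ, 1 ≤ k ∧ k ≤ n ∧ ∑ i, μ i ^ k ≠ 0 := by
  classical
  by_contra! h
  -- A polynomial of degree at most `n` without constant term that vanishes on all `μ i ≠ μ i₀`.
  let s : Finset K := ((Finset.univ.image μ).erase (μ i₀))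
  let p : Polynomial K := Polynomial.X * ∏ c ∈ s, (Polynomial.X - Polynomial.C c)
  have hs : s.card + 1 ≤ n := by
    rw [Finset.card_erase_add_one (Finset.mem_image_of_mem _ (Finset.mem_univ _))]
    exact Finset.card_image_le.trans (by simp)
  have hdeg : p.natDegree < n + 1 := by
    refine Nat.lt_succ_of_le (Polynomial.natDegree_mul_le.trans ?_)
    rw [Polynomial.natDegree_X, Polynomial.natDegree_prod_of_monic _ _
      fun c _ ↦ Polynomial.monic_X_sub_C c]
    simp only [Polynomial.natDegree_X_sub_C, Finset.sum_const, smul_eq_mul, mul_one]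
    omega
  have hsum : ∑ i, p.eval (μ i) = 0 := by
    simp_rw [Polynomial.eval_eq_sum_range' hdeg]
    rw [Finset.sum_comm]
    refine Finset.sum_eq_zero fun k hk ↦ ?_
    rw [← Finset.mul_sum]
    rcases Nat.eq_zero_or_pos k with rfl | hk0
    · simp [p, Polynomial.mul_coeff_zero]
    · rw [h k hk0 (Nat.lt_succ_iff.1 (Finset.mem_range.1 hk)), mul_zero]
  have heval (i : Fin n) : p.eval (μ i) = if μ i = μ i₀ then p.eval (μ i₀) else 0 := by
    split_ifs with hi
    · rw [hi]
    · have : μ i ∈ s := by simp [s, hi]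
      simp only [p, Polynomial.eval_mul, Polynomial.eval_prod, Polynomial.eval_sub,
        Polynomial.eval_X, Polynomial.eval_C]
      rw [Finset.prod_eq_zero this (sub_self _), mul_zero]
  have hp0 : p.eval (μ i₀) ≠ 0 := by
    simp only [p, Polynomial.eval_mul, Polynomial.eval_prod, Polynomial.eval_sub,
        Polynomial.eval_X, Polynomial.eval_C]
    refine mul_ne_zero hi₀ (Finset.prod_ne_zero_iff.2 fun c hc ↦ sub_ne_zero.2 ?_)
    exact (Finset.ne_of_mem_erase hc).symm
  rw [Finset.sum_congr rfl fun i _ ↦ heval i, ← Finset.sum_filter, Finset.sum_const,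
    nsmul_eq_mul] at hsum
  have hcard := (mul_eq_zero.1 hsum).resolve_right hp0
  rw [Nat.cast_eq_zero, Finset.card_eq_zero] at hcard
  exact Finset.notMem_empty i₀
    (hcard ▸ Finset.mem_filter.2 ⟨Finset.mem_univ _, rfl⟩)

/-- If the first nonzero power sum of some algebraic integers is the integer `p_m = z`, then
Newton's identity `m e_m = ± p_m` shows that `m` divides `z`. -/
lemma dvd_of_psum_eq (μ : Fin n → K) (hμ : ∀ i, IsIntegral ℤ (μ i)) {m : ℕ} (hm : 1 ≤ m)
    (h0 : ∀ k, 1 ≤ k → k < m → ∑ i, μ i ^ k = 0) {z : ℤ} (hz : ∑ i, μ i ^ m = z) :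
    (m : ℤ) ∣ z := by
  classical
  let e (k : ℕ) : K := MvPolynomial.aeval μ (MvPolynomial.esymm (Fin n) ℤ k)
  have hint (k : ℕ) : IsIntegral ℤ (e k) := by
    simp only [e, MvPolynomial.esymm, map_sum, map_prod, MvPolynomial.aeval_X]
    exact IsIntegral.sum _ fun t _ ↦ IsIntegral.prod _ fun i _ ↦ hμ i
  have hnewton : (m : K) * e m = (-1) ^ (m + 1) * z := by
    have := congr(MvPolynomial.aeval μ $(MvPolynomial.mul_esymm_eq_sum (Fin n) ℤ m))
    simp only [map_mul, map_natCast, map_pow, map_neg, map_one, map_sum, MvPolynomial.psum,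
      MvPolynomial.aeval_X] at this
    rw [Finset.sum_eq_single (0, m)] at this
    · simpa [MvPolynomial.esymm_zero, hz, e] using this
    · rintro ⟨a, b⟩ hab hne
      rw [Finset.mem_filter, Finset.HasAntidiagonal.mem_antidiagonal] at hab
      simp only at hab
      have ha : a ≠ 0 := by
        rintro rfl
        exact hne (by rw [← hab.1, zero_add])
      rw [h0 b (by omega) (by omega), mul_zero]
    · intro h
      exact absurd (by simp; omega) h
  have hm0 : (m : ℚ) ≠ 0 := Nat.cast_ne_zero.2 (by omega)
  have he : e m = algebraMap ℚ K ((-1) ^ (m + 1) * z / m) := by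
    simp only [map_div₀, map_mul, map_pow, map_neg, map_one, map_intCast, map_natCast]
    rw [← hnewton, mul_div_cancel_left₀ _ (Nat.cast_ne_zero.2 (by omega))]
  have hq := hint m
  rw [he, isIntegral_algebraMap_iff (algebraMap ℚ K).injective,
    IsIntegrallyClosed.isIntegral_iff] at hq
  obtain ⟨y, hy⟩ := hq
  rw [eq_div_iff hm0] at hy
  have hy' : y * m = (-1) ^ (m + 1) * z :=
    Int.cast_injective (α := ℚ) (by push_cast; exact hy)
  have : (m : ℤ) ∣ (-1) ^ (m + 1) * z := ⟨y, by rw [← hy', mul_comm]⟩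
  exact (IsUnit.dvd_mul_left (isUnit_one.neg.pow _)).1 this

end PowerSums

/-! ### Characters of tensor powers -/

section Characters

variable {K H : Type*} [Field K] [Ring H] [Bialgebra K H]

/-- The character of a representation. -/
def repChar {K H M : Type*} [Field K] [Ring H] [Algebra K H] [AddCommGroup M] [Module K M]
    (f : H →ₐ[K] Module.End K M) : H →ₗ[K] K :=
  LinearMap.trace K M ∘ₗ f.toLinearMap

lemma repChar_apply {M : Type*} [AddCommGroup M] [Module K M]
    (f : H →ₐ[K] Module.End K M) (h : H) : repChar f h = LinearMap.trace K M (f h) := rfl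

lemma tensorRep_repr {M N : Type*} [AddCommGroup M] [Module K M] [AddCommGroup N] [Module K N]
    (f : H →ₐ[K] Module.End K M) (g : H →ₐ[K] Module.End K N) {h : H} {ι : Type*}
    (r : Repr K h ι) :
    tensorRep f g h = ∑ i ∈ r.index, TensorProduct.map (f (r.left i)) (g (r.right i)) := by
  simp only [tensorRep, AlgHom.comp_apply, Bialgebra.comulAlgHom_apply]
  rw [← r.eq]
  simp only [map_sum, Algebra.TensorProduct.map_tmul, Module.endTensorEndAlgHom_apply]
  rfl

lemma repChar_tensorRep {M N : Type*} [AddCommGroup M] [Module K M] [AddCommGroup N] [Module K N]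
    [FiniteDimensional K M] [FiniteDimensional K N]
    (f : H →ₐ[K] Module.End K M) (g : H →ₐ[K] Module.End K N) :
    repChar (tensorRep f g) = repChar f ∘ₗ rightConv (repChar g) := by
  ext h
  rw [repChar_apply, tensorRep_repr f g (ℛ K h), map_sum, LinearMap.comp_apply,
    rightConv_repr _ (ℛ K h), map_sum]
  refine Finset.sum_congr rfl fun i _ ↦ ?_
  rw [LinearMap.trace_tensorProduct', map_smul, smul_eq_mul, mul_comm]
  rfl

lemma repChar_conj {M N : Type*} [AddCommGroup M] [Module K M] [AddCommGroup N] [Module K N]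
    (e : M ≃ₗ[K] N) (f : H →ₐ[K] Module.End K M) :
    repChar ((e.conjAlgEquiv K).toAlgHom.comp f) = repChar f := by
  ext h
  exact LinearMap.trace_conj' (f h) e

/-- The normalized integral acts on a representation as a projection onto the invariants. -/
lemma IsHaarIntegral.repChar_eq_finrank {Λ : H} (hΛ : IsHaarIntegral K Λ) {M : Type*}
    [AddCommGroup M] [Module K M] [FiniteDimensional K M] (f : H →ₐ[K] Module.End K M) :
    repChar f Λ = Module.finrank K (invariants f) := by
  have hproj : LinearMap.IsProj (invariants f) (f Λ) :=
    { map_mem := fun x h ↦ by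
        rw [← Module.End.mul_apply, ← map_mul, hΛ.mul_left, map_smul]; rfl
      map_id := fun x hx ↦ by rw [hx Λ, hΛ.counit_eq, one_smul] }
  exact hproj.trace

instance finiteDimensional_tensorPower {V : Type*} [AddCommGroup V] [Module K V]
    [FiniteDimensional K V] (m : ℕ) : FiniteDimensional K (⨂[K]^m V) :=
  Module.Finite.of_basis (Basis.piTensorProduct fun _ : Fin m ↦ Module.finBasis K V)

variable {V : Type*} [AddCommGroup V] [Module K V] [Module H V] [IsScalarTower K H V]

lemma repChar_powRep [FiniteDimensional K V] (m : ℕ) :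
    repChar (powRep K H V m) =
      counit (R := K) ∘ₗ (rightConv (repChar (Algebra.lsmul K K V : H →ₐ[K] _)) ^ m) := by
  induction m with
  | zero =>
    ext h
    have h1 : powRep K H V 0 h = counit (R := K) h • (1 : Module.End K (⨂[K]^0 V)) := by
      simp [powRep, Algebra.ofId_apply, Algebra.algebraMap_eq_smul_one]
    have h2 : Module.finrank K (⨂[K]^0 V) = 1 := by
      rw [(PiTensorProduct.isEmptyEquiv (R := K) (s := fun _ : Fin 0 ↦ V) (Fin 0)).finrank_eq,
        Module.finrank_self]
    rw [repChar_apply, h1, map_smul, LinearMap.trace_one, h2]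
    simp
  | succ m ih =>
    rw [powRep, repChar_conj, repChar_tensorRep, ih, LinearMap.comp_assoc, pow_succ]
    rfl

lemma rightConv_counit_comp_pow (χ : H →ₗ[K] K) (m : ℕ) :
    rightConv (counit (R := K) ∘ₗ (rightConv χ ^ m)) = rightConv χ ^ m := by
  induction m with
  | zero => exact rightConv_counit
  | succ m ih =>
    have : counit (R := K) ∘ₗ (rightConv χ ^ (m + 1)) =
      (counit (R := K) ∘ₗ (rightConv χ ^ m)) ∘ₗ rightConv χ := by rw [pow_succ]; rfl
    rw [this, rightConv_comp, ih, pow_succ]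
    rfl

end Characters

/-! ### Integrality of eigenvalues -/

section CharacterRing

variable {K H : Type*} [Field K] [Ring H]

/-- A trace function on a matrix algebra is a multiple of the trace. -/
lemma apply_eq_smul_trace {d : ℕ} (f : Matrix (Fin d) (Fin d) K →ₗ[K] K)
    (hf : ∀ x y, f (x * y) = f (y * x)) (i₀ : Fin d) (x : Matrix (Fin d) (Fin d) K) :
    f x = f (Matrix.single i₀ i₀ 1) * x.trace := by
  obtain ⟨c, hc⟩ : ∃ c, f (Matrix.single i₀ i₀ 1) = c := ⟨_, rfl⟩
  rw [hc]
  have h1 (j k : Fin d) : f (Matrix.single j k 1) = if j = k then c else 0 := by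
    have h2 : (Matrix.single j k 1 : Matrix (Fin d) (Fin d) K) =
      Matrix.single j i₀ 1 * Matrix.single i₀ k 1 := by simp
    rw [h2, hf]
    split_ifs with h
    · subst h; simp [hc]
    · rw [Matrix.single_mul_single_of_ne (h := Ne.symm h), map_zero]
  conv_lhs => rw [Matrix.matrix_eq_sum_single x]
  have h3 (j k : Fin d) : Matrix.single j k (x j k) = x j k • Matrix.single j k (1 : K) := by simp
  simp only [map_sum, h3, map_smul, h1, smul_eq_mul, mul_ite, mul_zero, Finset.sum_ite_eq,
    Finset.mem_univ, if_true]
  rw [← Finset.sum_mul, mul_comm]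
  rfl

/-- The representation of `H` on the simple module belonging to a matrix block of `H`. -/
def blockRep [Algebra K H] {r : ℕ} {d : Fin r → ℕ}
    (e : H ≃ₐ[K] ∀ i, Matrix (Fin (d i)) (Fin (d i)) K) (i : Fin r) :
    H →ₐ[K] Module.End K (Fin (d i) → K) :=
  (Matrix.toLinAlgEquiv'.toAlgHom.comp (Pi.evalAlgHom K _ i)).comp e.toAlgHom

/-- Every character is an integral combination of the characters of the matrix blocks, because
it is a trace function and takes integral values on idempotents. -/
lemma repChar_mem_span [CharZero K] [Algebra K H] {r : ℕ} {d : Fin r → ℕ} [hd : ∀ i, NeZero (d i)]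
    (e : H ≃ₐ[K] ∀ i, Matrix (Fin (d i)) (Fin (d i)) K) {M : Type*} [AddCommGroup M] [Module K M]
    [FiniteDimensional K M] (f : H →ₐ[K] Module.End K M) :
    repChar f ∈ Submodule.span ℤ (Set.range fun i ↦ repChar (blockRep e i)) := by
  classical
  let t (i : Fin r) : Matrix (Fin (d i)) (Fin (d i)) K →ₗ[K] K :=
    repChar f ∘ₗ e.symm.toLinearMap ∘ₗ
      LinearMap.single K (fun i ↦ Matrix (Fin (d i)) (Fin (d i)) K) i
  have ht (i) (x) : t i x = LinearMap.trace K M (f (e.symm (Pi.single i x))) := rfl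
  have htcomm (i) (x y) : t i (x * y) = t i (y * x) := by
    simp only [ht, Pi.single_mul, map_mul]
    exact LinearMap.trace_mul_comm K _ _
  have hnat (i) : ∃ c : ℕ, t i (Matrix.single 0 0 1) = c := by
    have hid : IsIdempotentElem (f (e.symm (Pi.single i (Matrix.single 0 0 1)))) := by
      rw [IsIdempotentElem, ← map_mul, ← map_mul, ← Pi.single_mul]
      simp
    exact ⟨_, trace_of_isIdempotentElem hid⟩
  choose c hc using hnat
  have hsum : repChar f = ∑ i, (c i : ℤ) • repChar (blockRep e i) := by
    ext h
    have h1 : h = ∑ i, e.symm (Pi.single i (e h i)) := by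
      rw [← map_sum, Finset.univ_sum_single, AlgEquiv.symm_apply_apply]
    have h2 : repChar f h = ∑ i, t i (e h i) := by
      conv_lhs => rw [h1, map_sum]
      rfl
    rw [h2, LinearMap.sum_apply]
    refine Finset.sum_congr rfl fun i _ ↦ ?_
    have h3 : repChar (blockRep e i) h = (e h i).trace := Matrix.trace_toLin'_eq _
    rw [apply_eq_smul_trace (t i) (htcomm i) 0, hc, LinearMap.smul_apply, h3]
    simp
  rw [hsum]
  exact Submodule.sum_mem _ fun i _ ↦ Submodule.smul_mem _ _ (Submodule.subset_span ⟨i, rfl⟩)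

/-- The eigenvalues of `h ↦ ∑ h₍₁₎ χ(h₍₂₎)`, for a character `χ`, are algebraic integers, because
the characters of `H` generate a finitely generated subring of `H*`. -/
lemma isIntegral_of_hasEigenvalue [IsAlgClosed K] [CharZero K] [Bialgebra K H]
    [IsSemisimpleRing H] [FiniteDimensional K H] {M : Type*} [AddCommGroup M] [Module K M]
    [FiniteDimensional K M] (f : H →ₐ[K] Module.End K M) {c : K}
    (hc : Module.End.HasEigenvalue (rightConv (repChar f)) c) : IsIntegral ℤ c := by
  obtain ⟨r, d, hd, ⟨e⟩⟩ := IsSemisimpleRing.exists_algEquiv_pi_matrix_of_isAlgClosed K H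
  obtain ⟨v, hv⟩ := hc.exists_hasEigenvector
  let C : Submodule ℤ (H →ₗ[K] K) :=
    Submodule.span ℤ (Set.range fun i ↦ repChar (blockRep e i))
  have hC (ψ) (hψ : ψ ∈ C) : ψ ∘ₗ rightConv (repChar f) ∈ C := by
    induction hψ using Submodule.span_induction with
    | mem x hx =>
      obtain ⟨i, rfl⟩ := hx
      change repChar (blockRep e i) ∘ₗ rightConv (repChar f) ∈ C
      rw [← repChar_tensorRep]
      exact repChar_mem_span e _
    | zero => rw [LinearMap.zero_comp]; exact C.zero_mem
    | add x y _ _ hx hy => rw [LinearMap.add_comp]; exact C.add_mem hx hy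
    | smul a x _ hx => rw [LinearMap.smul_comp]; exact C.smul_mem _ hx
  have hcounit : counit (R := K) ∈ C := by
    have : repChar (Algebra.ofId K (Module.End K K) |>.comp (Bialgebra.counitAlgHom K H)) =
        counit (R := K) := by
      ext h
      simp [repChar_apply, Algebra.ofId_apply, Algebra.algebraMap_eq_smul_one]
    rw [← this]
    exact repChar_mem_span e _
  let T : (H →ₗ[K] K) →ₗ[ℤ] H :=
    AddMonoidHom.toIntLinearMap
      { toFun := fun ψ ↦ rightConv ψ v
        map_zero' := by simp [rightConv_apply]
        map_add' := fun x y ↦ by simp [rightConv_apply, LinearMap.lTensor_add] }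
  have hT (ψ) : T ψ = rightConv ψ v := rfl
  refine isIntegral_of_smul_mem_submodule (C.map T) ?_
    ((Submodule.fg_span (Set.finite_range _)).map T) c ?_
  · intro h
    apply hv.2
    have : T (counit (R := K)) ∈ C.map T := Submodule.mem_map_of_mem hcounit
    rw [h, Submodule.mem_bot, hT, rightConv_counit] at this
    exact this
  · rintro _ ⟨ψ, hψ, rfl⟩
    refine ⟨ψ ∘ₗ rightConv (repChar f), hC ψ hψ, ?_⟩
    rw [hT, hT, rightConv_comp, LinearMap.comp_apply, hv.apply_eq_smul, map_smul]

end CharacterRing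

/-! ### Finite-dimensional modules -/

section FiniteDimensional

variable {K H V : Type*} [Field K] [IsAlgClosed K] [CharZero K] [Ring H] [HopfAlgebra K H]
  [IsSemisimpleRing H] [AddCommGroup V] [Module K V] [Module H V] [IsScalarTower K H V]
  [FiniteDimensional K V]

/-- The key identity: the numbers `dim H · dim (V^{⊗m})^H` are the power sums of the eigenvalues of
a single operator, convolution with the character of `V`. -/
lemma trace_rightConv_pow (m : ℕ) :
    LinearMap.trace K H (rightConv (repChar (Algebra.lsmul K K V : H →ₐ[K] _)) ^ m) =
      Module.finrank K H * Module.finrank K (powInvariants K H V m) := by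
  obtain ⟨Λ, hΛ⟩ := exists_isHaarIntegral K H
  rw [← rightConv_counit_comp_pow, hΛ.trace_rightConv_eq, ← repChar_powRep,
    hΛ.repChar_eq_finrank]
  rfl

/-- The unit of `H` is an eigenvector of convolution with `χ_V`, with eigenvalue `dim V ≠ 0`, so
one of the first `dim H` power sums of the eigenvalues is nonzero. -/
lemma exists_powInvariants_ne_bot_of_finiteDimensional [Nontrivial V] :
    ∃ m : ℕ, 1 ≤ m ∧ m ≤ Module.finrank K H ∧ powInvariants K H V m ≠ ⊥ := by
  obtain ⟨Λ, hΛ⟩ := exists_isHaarIntegral K H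
  have := hΛ.moduleFinite
  let χ := repChar (Algebra.lsmul K K V : H →ₐ[K] _)
  obtain ⟨n, μ, htr, -, hμ⟩ := exists_eigenvalue_family (rightConv χ)
  have hn : n = Module.finrank K H := by
    have := htr 0
    rw [pow_zero, LinearMap.trace_one] at this
    simpa using this.symm
  have hχ1 : χ 1 = Module.finrank K V := by
    rw [repChar_apply, map_one, LinearMap.trace_one]
  have hH : (1 : H) ≠ 0 := fun h ↦ by simpa using congr(counit (R := K) $h)
  obtain ⟨i₀, hi₀⟩ := hμ (χ 1) (Module.End.hasEigenvalue_of_hasEigenvector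
    (x := 1) ⟨Module.End.mem_eigenspace_iff.2 (rightConv_one χ), hH⟩)
  obtain ⟨k, hk1, hkn, hk⟩ := exists_psum_ne_zero μ (i₀ := i₀)
    (by rw [hi₀, hχ1]; exact Nat.cast_ne_zero.2 Module.finrank_pos.ne')
  refine ⟨k, hk1, hn ▸ hkn, fun h ↦ hk ?_⟩
  rw [← htr, trace_rightConv_pow, h, finrank_bot, Nat.cast_zero, mul_zero]

lemma dvd_finrank_mul_finrank {m : ℕ} (hm : 1 ≤ m)
    (h : ∀ k, 1 ≤ k → k < m → powInvariants K H V k = ⊥) :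
    m ∣ Module.finrank K H * Module.finrank K (powInvariants K H V m) := by
  obtain ⟨Λ, hΛ⟩ := exists_isHaarIntegral K H
  have := hΛ.moduleFinite
  obtain ⟨n, μ, htr, hμ, -⟩ :=
    exists_eigenvalue_family (rightConv (repChar (Algebra.lsmul K K V : H →ₐ[K] _)))
  have := dvd_of_psum_eq μ (fun i ↦ isIntegral_of_hasEigenvalue _ (hμ i)) hm
    (z := (Module.finrank K H * Module.finrank K (powInvariants K H V m) : ℕ))
    (fun k hk1 hkm ↦ by
      rw [← htr, trace_rightConv_pow, h k hk1 hkm, finrank_bot, Nat.cast_zero, mul_zero])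
    (by rw [← htr, trace_rightConv_pow]; push_cast; rfl)
  exact_mod_cast this

end FiniteDimensional

/-! ### Tensor powers of submodules -/

section Functoriality

variable {K H U V : Type*} [Field K] [Ring H] [Bialgebra K H]
  [AddCommGroup U] [Module K U] [Module H U] [IsScalarTower K H U]
  [AddCommGroup V] [Module K V] [Module H V] [IsScalarTower K H V]

/-- The map `U^{⊗m} → V^{⊗m}` induced by a linear map `U → V`. -/
def powMap {K U V : Type*} [Field K] [AddCommGroup U] [Module K U] [AddCommGroup V] [Module K V]
    (i : U →ₗ[K] V) (m : ℕ) : (⨂[K]^m U) →ₗ[K] (⨂[K]^m V) :=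
  PiTensorProduct.map fun _ ↦ i

lemma powMap_tprod (i : U →ₗ[K] V) {m : ℕ} (u : Fin m → U) :
    powMap i m (PiTensorProduct.tprod K u) = PiTensorProduct.tprod K fun j ↦ i (u j) :=
  PiTensorProduct.map_tprod _ _

lemma powMap_injective {i : U →ₗ[K] V} (hi : Function.Injective i) (m : ℕ) :
    Function.Injective (powMap i m) := by
  obtain ⟨r, hr⟩ := i.exists_leftInverse_of_injective (LinearMap.ker_eq_bot.2 hi)
  have : powMap r m ∘ₗ powMap i m = LinearMap.id := by
    rw [powMap, powMap, ← PiTensorProduct.map_comp]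
    simp only [hr]
    exact PiTensorProduct.map_id
  exact Function.LeftInverse.injective (g := powMap r m) fun x ↦ congr($this x)

lemma powSuccEquiv_tprod_tmul (m : ℕ) (v : Fin m → V) (w : V) :
    powSuccEquiv K V m (PiTensorProduct.tprod K v ⊗ₜ w) =
      PiTensorProduct.tprod K (Fin.append v fun _ : Fin 1 ↦ w) := by
  simp only [powSuccEquiv, LinearEquiv.trans_apply, TensorProduct.congr_tmul,
    LinearEquiv.refl_apply, PiTensorProduct.subsingletonEquiv_symm_apply']
  exact TensorPower.tprod_mul_tprod K v fun _ : Fin 1 ↦ w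

lemma powMap_powSuccEquiv (i : U →ₗ[K] V) (m : ℕ) (x : (⨂[K]^m U) ⊗[K] U) :
    powMap i (m + 1) (powSuccEquiv K U m x) =
      powSuccEquiv K V m (TensorProduct.map (powMap i m) i x) := by
  have : powMap i (m + 1) ∘ₗ (powSuccEquiv K U m).toLinearMap =
      (powSuccEquiv K V m).toLinearMap ∘ₗ TensorProduct.map (powMap i m) i := by
    apply TensorProduct.ext
    ext u w
    change powMap i (m + 1) (powSuccEquiv K U m (PiTensorProduct.tprod K u ⊗ₜ w)) =
      powSuccEquiv K V m (powMap i m (PiTensorProduct.tprod K u) ⊗ₜ i w)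
    rw [powSuccEquiv_tprod_tmul, powMap_tprod, powMap_tprod, powSuccEquiv_tprod_tmul]
    congr 1
    funext j
    refine Fin.addCases (fun j ↦ ?_) (fun j ↦ ?_) j <;> simp
  exact congr($this x)

lemma powRep_succ_powSuccEquiv (m : ℕ) (h : H) (y : (⨂[K]^m V) ⊗[K] V) :
    powRep K H V (m + 1) h (powSuccEquiv K V m y) =
      powSuccEquiv K V m (tensorRep (powRep K H V m) (Algebra.lsmul K K V) h y) := by
  simp [powRep, LinearEquiv.conjAlgEquiv_apply]

lemma powMap_powRep (i : U →ₗ[H] V) (m : ℕ) (h : H) (x : ⨂[K]^m U) :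
    powMap (i.restrictScalars K) m (powRep K H U m h x) =
      powRep K H V m h (powMap (i.restrictScalars K) m x) := by
  induction m generalizing h with
  | zero => simp [powRep, Algebra.ofId_apply, Algebra.algebraMap_eq_smul_one]
  | succ m ih =>
    obtain ⟨x, rfl⟩ := (powSuccEquiv K U m).surjective x
    rw [powRep_succ_powSuccEquiv, powMap_powSuccEquiv, powMap_powSuccEquiv,
      powRep_succ_powSuccEquiv]
    congr 1
    rw [tensorRep_repr _ _ (ℛ K h), tensorRep_repr _ _ (ℛ K h), LinearMap.sum_apply,
      LinearMap.sum_apply, map_sum]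
    refine Finset.sum_congr rfl fun j _ ↦ ?_
    induction x with
    | zero => simp
    | add x y hx hy => simp only [map_add, hx, hy]
    | tmul x y => simp [ih]

lemma powMap_mem_powInvariants_iff {i : U →ₗ[H] V} (hi : Function.Injective i) {m : ℕ}
    {x : ⨂[K]^m U} :
    powMap (i.restrictScalars K) m x ∈ powInvariants K H V m ↔ x ∈ powInvariants K H U m := by
  refine forall_congr' fun h ↦ ?_
  have hinj := powMap_injective (i := i.restrictScalars K) hi m
  change powRep K H V m h _ = _ ↔ powRep K H U m h x = _
  rw [← powMap_powRep, ← map_smul, hinj.eq_iff]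

lemma powInvariants_ne_bot {i : U →ₗ[H] V} (hi : Function.Injective i) {m : ℕ}
    (hU : powInvariants K H U m ≠ ⊥) : powInvariants K H V m ≠ ⊥ := by
  obtain ⟨x, hx, hx0⟩ := Submodule.exists_mem_ne_zero_of_ne_bot hU
  refine (Submodule.ne_bot_iff _).2 ⟨_, (powMap_mem_powInvariants_iff hi).2 hx, fun h ↦ hx0 ?_⟩
  exact powMap_injective (i := i.restrictScalars K) hi m (h.trans (map_zero _).symm)

/-- If the invariants of `V^{⊗m}` all come from a submodule `U`, then they are the invariants of
`U^{⊗m}`. -/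
lemma finrank_powInvariants_eq {i : U →ₗ[H] V} (hi : Function.Injective i) {m : ℕ}
    (hrange : powInvariants K H V m ≤ LinearMap.range (powMap (i.restrictScalars K) m)) :
    Module.finrank K (powInvariants K H U m) = Module.finrank K (powInvariants K H V m) := by
  have hinj := powMap_injective (i := i.restrictScalars K) hi m
  have : (powInvariants K H U m).map (powMap (i.restrictScalars K) m) =
      powInvariants K H V m := by
    refine le_antisymm ?_ fun y hy ↦ ?_
    · rintro _ ⟨x, hx, rfl⟩
      exact (powMap_mem_powInvariants_iff hi).2 hx
    · obtain ⟨x, rfl⟩ := hrange hy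
      exact ⟨x, (powMap_mem_powInvariants_iff hi).1 hy, rfl⟩
  rw [← this]
  exact (Submodule.equivMapOfInjective _ hinj _).finrank_eq

/-- A finite-dimensional space of tensors lies in the tensor power of a finitely generated
submodule. -/
lemma exists_fg_le_range_powMap {m : ℕ} (N : Submodule K (⨂[K]^m V)) (hN : N.FG) :
    ∃ W : Submodule H V, W.FG ∧
      N ≤ LinearMap.range (powMap (W.subtype.restrictScalars K) m) := by
  have hmono {W W' : Submodule H V} (hW : W ≤ W') :
      LinearMap.range (powMap (W.subtype.restrictScalars K) m) ≤
        LinearMap.range (powMap (W'.subtype.restrictScalars K) m) := by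
    have : powMap (W.subtype.restrictScalars K) m =
        powMap (W'.subtype.restrictScalars K) m ∘ₗ
          powMap ((Submodule.inclusion hW).restrictScalars K) m := by
      rw [powMap, powMap, powMap, ← PiTensorProduct.map_comp]
      rfl
    rw [this]
    exact LinearMap.range_comp_le_range _ _
  have hsup (P Q : Submodule K (⨂[K]^m V))
      (hP : ∃ W : Submodule H V, W.FG ∧
        P ≤ LinearMap.range (powMap (W.subtype.restrictScalars K) m))
      (hQ : ∃ W : Submodule H V, W.FG ∧
        Q ≤ LinearMap.range (powMap (W.subtype.restrictScalars K) m)) :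
      ∃ W : Submodule H V, W.FG ∧
        P ⊔ Q ≤ LinearMap.range (powMap (W.subtype.restrictScalars K) m) := by
    obtain ⟨W, hW, hPW⟩ := hP
    obtain ⟨W', hW', hQW⟩ := hQ
    exact ⟨W ⊔ W', hW.sup hW', sup_le (hPW.trans (hmono le_sup_left))
      (hQW.trans (hmono le_sup_right))⟩
  have hspan (x : ⨂[K]^m V) : ∃ W : Submodule H V, W.FG ∧
      Submodule.span K {x} ≤ LinearMap.range (powMap (W.subtype.restrictScalars K) m) := by
    induction x using PiTensorProduct.induction_on with
    | smul_tprod c v =>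
      refine ⟨Submodule.span H (Set.range v), Submodule.fg_span (Set.finite_range v), ?_⟩
      rw [Submodule.span_singleton_le_iff_mem]
      refine Submodule.smul_mem _ _ ⟨PiTensorProduct.tprod K fun j ↦
        ⟨v j, Submodule.subset_span ⟨j, rfl⟩⟩, ?_⟩
      rw [powMap_tprod]
      rfl
    | add x y hx hy =>
      obtain ⟨W, hW, hxy⟩ := hsup _ _ hx hy
      refine ⟨W, hW, ?_⟩
      rw [Submodule.span_singleton_le_iff_mem]
      rw [sup_le_iff, Submodule.span_singleton_le_iff_mem,
        Submodule.span_singleton_le_iff_mem] at hxy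
      exact Submodule.add_mem _ hxy.1 hxy.2
  induction N, hN using Submodule.fg_induction with
  | singleton x => exact hspan x
  | sup P Q hP hQ h1 h2 => exact hsup P Q h1 h2

end Functoriality

/-! ### Modules of arbitrary dimension -/

section Order

lemma finiteDimensional_of_fg {K H V : Type*} [Field K] [Ring H] [HopfAlgebra K H]
    [IsSemisimpleRing H] [AddCommGroup V] [Module K V] [Module H V] [IsScalarTower K H V]
    {W : Submodule H V} (hW : W.FG) : FiniteDimensional K W := by
  obtain ⟨Λ, hΛ⟩ := exists_isHaarIntegral K H
  have := hΛ.moduleFinite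
  have : Module.Finite H W := Module.Finite.iff_fg.2 hW
  exact Module.Finite.trans H W

variable {K H V : Type*} [Field K] [IsAlgClosed K] [CharZero K] [Ring H] [HopfAlgebra K H]
  [IsSemisimpleRing H] [AddCommGroup V] [Module K V] [Module H V] [IsScalarTower K H V]

lemma exists_powInvariants_ne_bot [Nontrivial V] :
    ∃ m : ℕ, 1 ≤ m ∧ m ≤ Module.finrank K H ∧ powInvariants K H V m ≠ ⊥ := by
  obtain ⟨v, hv⟩ := exists_ne (0 : V)
  let W : Submodule H V := Submodule.span H {v}
  have : FiniteDimensional K W := finiteDimensional_of_fg (Submodule.fg_span_singleton v)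
  have : Nontrivial W := (Submodule.nontrivial_iff_ne_bot).2 (by simpa [W] using hv)
  obtain ⟨m, h1, hn, hm⟩ :=
    exists_powInvariants_ne_bot_of_finiteDimensional (K := K) (H := H) (V := W)
  exact ⟨m, h1, hn, powInvariants_ne_bot W.injective_subtype hm⟩

lemma dvd_finrank_mul_finrank_powInvariants {m : ℕ} (hm : 1 ≤ m)
    (h : ∀ k, 1 ≤ k → k < m → powInvariants K H V k = ⊥) :
    m ∣ Module.finrank K H * Module.finrank K (powInvariants K H V m) := by
  by_cases hfin : FiniteDimensional K (powInvariants K H V m)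
  · obtain ⟨W, hW, hrange⟩ := exists_fg_le_range_powMap (H := H) (powInvariants K H V m)
      (Module.Finite.iff_fg.1 hfin)
    have : FiniteDimensional K W := finiteDimensional_of_fg hW
    rw [← finrank_powInvariants_eq W.injective_subtype hrange]
    refine dvd_finrank_mul_finrank hm fun k hk1 hkm ↦ ?_
    by_contra hk
    exact powInvariants_ne_bot W.injective_subtype hk (h k hk1 hkm)
  · -- `Module.finrank` is `0` on an infinite-dimensional space.
    rw [Module.finrank_of_infinite_dimensional hfin, mul_zero]
    exact dvd_zero m

end Order

end HopfModule

end

theorem mainTheorem2 {K H V : Type*} [Field K] [IsAlgClosed K] [CharZero K]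
    [Ring H] [HopfAlgebra K H] [IsSemisimpleRing H]
    [AddCommGroup V] [Module K V] [Module H V] [IsScalarTower K H V] [Nontrivial V] :
    ∃ m : ℕ, HopfModule.ord K H V = (m : ℕ∞) ∧
      m ≤ Module.finrank K H ∧
      m ∣ Module.finrank K H * HopfModule.mult K H V := by
  classical
  obtain ⟨k, hk1, hkn, hk⟩ := HopfModule.exists_powInvariants_ne_bot (K := K) (H := H) (V := V)
  have hex : ∃ m : ℕ, 1 ≤ m ∧ HopfModule.powInvariants K H V m ≠ ⊥ := ⟨k, hk1, hk⟩
  have hord : HopfModule.ord K H V = (Nat.find hex : ℕ∞) := by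
    refine le_antisymm (sInf_le ⟨_, (Nat.find_spec hex).1, (Nat.find_spec hex).2, rfl⟩)
      (le_sInf ?_)
    rintro _ ⟨m, hm1, hm, rfl⟩
    exact_mod_cast Nat.find_min' hex ⟨hm1, hm⟩
  refine ⟨Nat.find hex, hord, (Nat.find_min' hex ⟨hk1, hk⟩).trans hkn, ?_⟩
  rw [HopfModule.mult, hord, ENat.toNat_natCast]
  refine HopfModule.dvd_finrank_mul_finrank_powInvariants (Nat.find_spec hex).1
    fun j hj1 hj ↦ ?_
  by_contra hne
  exact Nat.find_min hex hj ⟨hj1, hne⟩
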